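/- Let $n\ge 1$ be odd. The free $n$-foil is the knot diagram without over/under information obtained from two horizontal strands twisted $n$ times (the free $n$ tangle, a horizontal row of $n$ crossings) by joining its two upper ends to each other and its two lower ends to each other. An assignment chooses the overstrand at each of the $n$ crossings, so there are $2^n$ assignments. For odd $k\ge 1$, the left (respectively right) $k$-foil is the diagram obtained from the free $k$-foil by letting the strand of positive (respectively negative) slope be the overstrand at every crossing. Knots are knot diagrams in the plane up to planar isotopy and Reidemeister moves; a knot and its mirror image are not identified. Then every assignment of the free $n$-foil produces a knot diagram, and: 1. For every odd $k$ with $1\le k\le n$, exactly $\binom{n}{(n-k)/2}$ assignments produce a diagram which can be turned into the standard diagram of the left $k$-foil by planar isotopies and cancellations of pairs of crossings with the second Reidemeister move, and exactly $\binom{n}{(n-k)/2}$ assignments produce a diagram which can be so turned into that of the right $k$-foil. 2. For every odd $k$ with $3\le k\le n$, exactly $\binom{n}{(n-k)/2}$ assignments produce a diagram of the same knot as the left $k$-foil, and exactly $\binom{n}{(n-k)/2}$ produce a diagram of the same knot as the right $k$-foil. 3. For $k=1$, where the left and the right $1$-foil are both the unknot, exactly $2\binom{n}{(n-1)/2}$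 assignments produce a diagram of the unknot. -/

import Mathlib

/-!  Combinatorial knot diagrams on the sphere, Reidemeister moves, and the free foils.

A diagram is a 4-valent graph drawn in the plane, encoded as a combinatorial map: every edge is
cut into two half-edges ("darts"), and at every vertex the darts are listed in counterclockwise
order.  Edges may be subdivided by 2-valent vertices ("arcs"), which carry no information; they
allow circles without crossings to be represented.  -/

namespace FreeKnot

/-- The two darts `(e, false)` and `(e, true)` are the two halves of the edge named `e`. -/
abbrev Dart := ℕ × Bool

/-- The other half of the same edge. -/
def Dart.flip (h : Dart) : Dart := (h.1, !h.2)

/-- The vertices of a diagram, given by their darts. -/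
inductive Piece where
  /-- A crossing with darts `a, b, c, d` in counterclockwise order; the understrand
  is `a`–`c` and the overstrand is `b`–`d`. -/
  | crossing (a b c d : Dart)
  /-- A 2-valent subdivision vertex: a crossingless strand from `a` to `b`. -/
  | arc (a b : Dart)

namespace Piece

/-- The darts at a vertex, in counterclockwise order. -/
def darts : Piece → List Dart
  | crossing a b c d => [a, b, c, d]
  | arc a b => [a, b]

/-- The corners at a vertex: pairs (dart, next dart counterclockwise). -/
def corners : Piece → List (Dart × Dart)
  | crossing a b c d => [(a, b), (b, c), (c, d), (d, a)]
  | arc a b => [(a, b), (b, a)]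

/-- The strands through a vertex, as pairs of opposite darts. -/
def strands : Piece → List (Dart × Dart)
  | crossing a b c d => [(a, c), (b, d)]
  | arc a b => [(a, b)]

/-- Renaming darts. -/
def map (f : Dart → Dart) : Piece → Piece
  | crossing a b c d => crossing (f a) (f b) (f c) (f d)
  | arc a b => arc (f a) (f b)

end Piece

/-- A diagram, as its list of vertices. -/
abbrev Diagram := List Piece

namespace Diagram

/-- All darts occurring in a diagram. -/
def darts (D : Diagram) : List Dart := D.flatMap Piece.darts

/-- Every dart occurs at most once, and both halves of every edge occur. -/
def IsClosed (D : Diagram) : Prop :=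
  D.darts.Nodup ∧ ∀ h ∈ D.darts, h.flip ∈ D.darts

/-- A dart `x` stands for the corner between `x` and the next dart `h` counterclockwise at the same
vertex. Following the edge of `h` along the side on which that corner lies leads to the corner
which starts at the other half of that edge. -/
def FaceStep (D : Diagram) (x y : {h : Dart // h ∈ D.darts}) : Prop :=
  ∃ p ∈ D, ∃ h : Dart, (x.1, h) ∈ p.corners ∧ y.1 = h.flip

/-- The number of faces of the diagram. -/
noncomputable def faceCount (D : Diagram) : ℕ := Nat.card (Quot D.FaceStep)

/-- Moving along a strand: along an edge, or straight through a vertex. -/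
def StrandStep (D : Diagram) (x y : {h : Dart // h ∈ D.darts}) : Prop :=
  y.1 = x.1.flip ∨ ∃ p ∈ D, (x.1, y.1) ∈ p.strands

/-- The number of link components. -/
noncomputable def componentCount (D : Diagram) : ℕ := Nat.card (Quot D.StrandStep)

/-- A planar diagram of a knot: a closed diagram with one component (hence connected) whose
Euler characteristic `V - E + F` is `2`; the number `E` of edges is half the number of darts. -/
structure IsKnotDiagram (D : Diagram) : Prop where
  closed : D.IsClosed
  one_component : D.componentCount = 1
  planar : 2 * (D.length + D.faceCount) = D.darts.length + 4

/-- Elementary changes of the encoding, which do not change the drawn diagram up to isotopy. -/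
inductive PlanarIsotopy : Diagram → Diagram → Prop
  | perm (D D' : Diagram) (h : D.Perm D') : PlanarIsotopy D D'
  | rename (σ : Dart → Dart) (hσ : Function.Injective σ) (hflip : ∀ x, σ x.flip = (σ x).flip)
      (D : Diagram) : PlanarIsotopy D (D.map (Piece.map σ))
  | rotate (a b c d : Dart) (D : Diagram) :
      PlanarIsotopy (.crossing a b c d :: D) (.crossing c d a b :: D)
  | reverse (a b : Dart) (D : Diagram) : PlanarIsotopy (.arc a b :: D) (.arc b a :: D)
  /-- Removing a subdivision vertex: the remaining halves of its two edges form one edge. -/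
  | smooth (a b : Dart) (hab : b ≠ a.flip) (D : Diagram) :
      PlanarIsotopy (.arc a b :: D) (D.map (Piece.map fun x => if x = b.flip then a else x))

/-- First Reidemeister move: removing a kink (of either sign). -/
inductive ReidemeisterI : Diagram → Diagram → Prop
  | under_first (x b c : Dart) (D : Diagram) :
      ReidemeisterI (.crossing x x.flip b c :: D) (.arc b c :: D)
  | over_first (x b c : Dart) (D : Diagram) :
      ReidemeisterI (.crossing b x x.flip c :: D) (.arc b c :: D)

/-- Second Reidemeister move: cancelling two crossings which bound a bigon with edges `l`, `r`
and in which the same strand is the overstrand. The overstrand runs from `ul` to `dl`, the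
understrand from `ur` to `dr`. -/
inductive ReidemeisterII : Diagram → Diagram → Prop
  | cancel (ul ur dl dr l r : Dart) (D : Diagram) :
      ReidemeisterII (.crossing ur ul l r :: .crossing l.flip dl dr r.flip :: D)
        (.arc ul dl :: .arc ur dr :: D)

/-- Third Reidemeister move: a top strand from `t₁` to `t₂`, a middle strand from `m₁` to `m₂` and
a bottom strand from `b₁` to `b₂` bound a triangle with edges `t`, `m`, `b`. The six outer darts
are met counterclockwise in the order `t₁ m₁ b₁ t₂ m₂ b₂` (`tmb`) or `t₁ b₁ m₁ t₂ b₂ m₂` (`tbm`). -/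
inductive ReidemeisterIII : Diagram → Diagram → Prop
  | tmb (t₁ t₂ m₁ m₂ b₁ b₂ t m b : Dart) (D : Diagram) :
      ReidemeisterIII
        (.crossing m₁ t m t₁ :: .crossing b₁ t₂ b t.flip :: .crossing b.flip m₂ b₂ m.flip :: D)
        (.crossing b t b₂ t₁ :: .crossing m t₂ m₂ t.flip :: .crossing b₁ m.flip b.flip m₁ :: D)
  | tbm (t₁ t₂ m₁ m₂ b₁ b₂ t m b : Dart) (D : Diagram) :
      ReidemeisterIII
        (.crossing b₁ t b t₁ :: .crossing m₁ t₂ m t.flip :: .crossing b.flip m.flip b₂ m₂ :: D)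
        (.crossing m t m₂ t₁ :: .crossing b t₂ b₂ t.flip :: .crossing b₁ m₁ b.flip m.flip :: D)

/-- Two knot diagrams represent the same knot: they are connected by planar isotopies and
Reidemeister moves (in both directions) through planar knot diagrams. Mirror images are not
identified. -/
def SameKnot : Diagram → Diagram → Prop :=
  Relation.EqvGen fun D D' => D.IsKnotDiagram ∧ D'.IsKnotDiagram ∧
    (PlanarIsotopy D D' ∨ ReidemeisterI D D' ∨ ReidemeisterII D D' ∨ ReidemeisterIII D D')

/-- The first diagram becomes the second by planar isotopies and by cancelling pairs of crossings
with the second Reidemeister move. -/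
def CancelsTo : Diagram → Diagram → Prop :=
  Relation.ReflTransGen fun D D' => D.IsKnotDiagram ∧ D'.IsKnotDiagram ∧
    (PlanarIsotopy D D' ∨ PlanarIsotopy D' D ∨ ReidemeisterII D D')

/-- The diagram of the unknot without crossings: one edge, closed up. -/
def unknot : Diagram := [.arc (0, false) (0, true)]

end Diagram

/-- A free crossing: a 4-valent vertex with darts in counterclockwise order; its two strands are
`a`–`c` and `b`–`d`. -/
structure FreeCrossing where
  (a b c d : Dart)

/-- Assigning a free crossing: `b`–`d` becomes the overstrand if `s = true`, and `a`–`c`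
becomes the overstrand if `s = false`. -/
def FreeCrossing.assign (x : FreeCrossing) (s : Bool) : Piece :=
  if s then .crossing x.a x.b x.c x.d else .crossing x.b x.c x.d x.a

/-- A free diagram with `n` crossings (no over/under information), with its subdivision
vertices. -/
structure FreeDiagram (n : ℕ) where
  crossings : Fin n → FreeCrossing
  arcs : List (Dart × Dart)

/-- An assignment chooses the overstrand at each of the `n` free crossings. -/
abbrev Assignment (n : ℕ) := Fin n → Bool

/-- The diagram which an assignment produces from a free diagram. -/
def FreeDiagram.resultant {n : ℕ} (F : FreeDiagram n) (s : Assignment n) : Diagram :=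
  List.ofFn (fun i => (F.crossings i).assign (s i)) ++ F.arcs.map fun p => .arc p.1 p.2

/-- A free tangle with four ends; each end is the outer dart of the edge that leaves the tangle in
the given corner. -/
structure FreeTangle (n : ℕ) where
  crossings : Fin n → FreeCrossing
  (nw ne sw se : Dart)

/-- The closure joins the two upper ends and the two lower ends. -/
def FreeTangle.closure {n : ℕ} (T : FreeTangle n) : FreeDiagram n where
  crossings := T.crossings
  arcs := [(T.nw, T.ne), (T.sw, T.se)]

/-- The free `n` tangle: two horizontal strands twisted `n` times, with the crossings in a row from
left to right. The upper and lower edges between the crossings number `i - 1` and `i` are named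
`2 * i` and `2 * i + 1`; their left halves carry `false`, their right halves `true`. The darts of a
crossing are listed in the order north-west, south-west, south-east, north-east, so
`true` makes the strand with positive slope the overstrand. -/
def freeTwist (n : ℕ) : FreeTangle n where
  crossings i :=
    { a := (2 * (i : ℕ), true)
      b := (2 * (i : ℕ) + 1, true)
      c := (2 * ((i : ℕ) + 1) + 1, false)
      d := (2 * ((i : ℕ) + 1), false) }
  nw := (0, false)
  sw := (1, false)
  ne := (2 * n, true)
  se := (2 * n + 1, true)

/-- The free `n`-foil: the closure of the free `n` tangle. -/
def freeFoil (n : ℕ) : FreeDiagram n := (freeTwist n).closure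

/-- The left `k`-foil: the closure of the `+k` tangle (all overstrands have positive slope). For odd
`k` both strands run through the twist in the same direction, so all crossings are negative:
for `k = 3` this is the left-handed trefoil. -/
def leftFoil (k : ℕ) : Diagram := (freeFoil k).resultant fun _ => true

/-- The right `k`-foil: the closure of the `-k` tangle (all overstrands have negative slope). -/
def rightFoil (k : ℕ) : Diagram := (freeFoil k).resultant fun _ => false

end FreeKnot

/-! ### Knot diagrams under changes of the encoding -/

namespace FreeKnot

/-! An assignment is a word in two letters. Two neighbouring crossings with opposite letters bound a
bigon with one strand on top throughout, so the second Reidemeister move cancels them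
(`cancelsTo_foil_append`). Repeating this leaves a constant word `b ... b` of odd length `k`, where
`k` is the excess of `b` over the other letter (`exists_cancelsTo_replicate`). An assignment with
excess `k` of a given letter has `(n - k) / 2` copies of the other one, which explains the binomial
coefficients. It remains to show that the constant words of odd length give different knots, apart
from the two unknots with `k = 1`, and that even those two are not related by cancellations.

The invariant is a real form of the Kauffman bracket, written as a state sum. Every edge gets one of
three colours, and a crossing has weight `p * (δ δ) + q * (δ δ)` for its two smoothings, so that a
closed loop counts `3`. With `p * q = -1` and `p ^ 2 + q ^ 2 = 3` the sum is unchanged by the third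
move, changes sign under the second, and is multiplied by `p ^ 3` or `q ^ 3` under the first. The
solution used is `p = g`, `q = -g⁻¹` with `g` the golden ratio. Hence the absolute value is a knot
invariant up to integer powers of `g`, and it is preserved exactly when the first move is not used.

A twist of equal crossings is a power of a transfer matrix `α + β P` on pairs of colours with `P ^ 2
= 3 P`, and closing it takes the trace: `8 * q ^ k + p ^ (3 * k)` for the left `k`-foil and `8 * p ^
k + q ^ (3 * k)` for the right one (`partition_foil_replicate`). Up to powers of `g` these are `3`
for `k = 1`, and for `k ≥ 3` numbers just below `1` (left) or `8` (right). No integer power of `g`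
comes near the ratios of `1`, `3` and `8`, and within one family the small correction `g ^ (-4 * k)`
determines `k` (`foilValue_eq_zpow_mul`). The two 1-foils have the exact values `3 * g ^ (-3)` and
`3 * g ^ 3`, so cancellations cannot turn one into the other. -/

theorem card_quot_eq {α β : Type*} {r : α → α → Prop} {r' : β → β → Prop}
    (f : α → Quot r') (g : β → Quot r)
    (hf : ∀ x y, r x y → f x = f y) (hg : ∀ x y, r' x y → g x = g y)
    (hgf : ∀ x, Quot.lift g hg (f x) = Quot.mk r x)
    (hfg : ∀ y, Quot.lift f hf (g y) = Quot.mk r' y) :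
    Nat.card (Quot r) = Nat.card (Quot r') := by
  refine Nat.card_congr ⟨Quot.lift f hf, Quot.lift g hg, ?_, ?_⟩
  · rintro ⟨x⟩; exact hgf x
  · rintro ⟨y⟩; exact hfg y

theorem card_quot_subtype_eq {α : Type*} {P Q : α → Prop} (hPQ : ∀ x, P x ↔ Q x)
    {r : {x // P x} → {x // P x} → Prop} {r' : {x // Q x} → {x // Q x} → Prop}
    (h : ∀ x y, r x y → Quot.mk r' ⟨x.1, (hPQ _).1 x.2⟩ = Quot.mk r' ⟨y.1, (hPQ _).1 y.2⟩)
    (h' : ∀ x y, r' x y → Quot.mk r ⟨x.1, (hPQ _).2 x.2⟩ = Quot.mk r ⟨y.1, (hPQ _).2 y.2⟩) :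
    Nat.card (Quot r) = Nat.card (Quot r') :=
  card_quot_eq (fun x => Quot.mk r' ⟨x.1, (hPQ _).1 x.2⟩) (fun x => Quot.mk r ⟨x.1, (hPQ _).2 x.2⟩)
    h h' (fun _ => rfl) (fun _ => rfl)

@[simp] theorem Dart.flip_flip (x : Dart) : x.flip.flip = x := by simp [Dart.flip]

theorem Dart.flip_injective : Function.Injective Dart.flip :=
  Function.LeftInverse.injective Dart.flip_flip

@[simp] theorem Dart.flip_inj {x y : Dart} : x.flip = y.flip ↔ x = y := Dart.flip_injective.eq_iff

@[simp] theorem Dart.flip_ne (x : Dart) : x.flip ≠ x := by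
  rcases x with ⟨e, _ | _⟩ <;> simp [Dart.flip]

@[simp] theorem Dart.flip_fst (x : Dart) : x.flip.1 = x.1 := rfl

theorem Dart.fst_eq_iff {x y : Dart} : x.1 = y.1 ↔ x = y ∨ x = y.flip := by
  rcases x with ⟨e, _ | _⟩ <;> rcases y with ⟨e', _ | _⟩ <;> simp [Dart.flip]

theorem Dart.flip_eq_iff {x y : Dart} : x.flip = y ↔ x = y.flip := by
  constructor <;> rintro rfl <;> simp

namespace Piece

@[simp] theorem darts_map (f : Dart → Dart) (p : Piece) : (p.map f).darts = p.darts.map f := by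
  cases p <;> rfl

theorem corners_map (f : Dart → Dart) (p : Piece) :
    (p.map f).corners = p.corners.map (Prod.map f f) := by
  cases p <;> rfl

theorem strands_map (f : Dart → Dart) (p : Piece) :
    (p.map f).strands = p.strands.map (Prod.map f f) := by
  cases p <;> rfl

theorem mem_darts_of_mem_corners {p : Piece} {x y : Dart} (h : (x, y) ∈ p.corners) :
    x ∈ p.darts ∧ y ∈ p.darts := by
  cases p <;> simp [corners, darts] at h ⊢ <;> aesop

theorem mem_darts_of_mem_strands {p : Piece} {x y : Dart} (h : (x, y) ∈ p.strands) :
    x ∈ p.darts ∧ y ∈ p.darts := by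
  cases p <;> simp [strands, darts] at h ⊢ <;> aesop

end Piece

namespace Diagram

theorem mem_darts {D : Diagram} {x : Dart} : x ∈ D.darts ↔ ∃ p ∈ D, x ∈ p.darts :=
  List.mem_flatMap

@[simp] theorem darts_cons (p : Piece) (D : Diagram) : darts (p :: D) = p.darts ++ D.darts := rfl

@[simp] theorem darts_append (D D' : Diagram) : darts (D ++ D') = D.darts ++ D'.darts :=
  List.flatMap_append

@[simp] theorem darts_map (σ : Dart → Dart) (D : Diagram) :
    darts (D.map (Piece.map σ)) = D.darts.map σ := by
  induction D with
  | nil => rfl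
  | cons p D ih => simp only [List.map_cons, darts_cons, ih, Piece.darts_map, List.map_append]

theorem darts_perm {D D' : Diagram} (h : D.Perm D') : D.darts.Perm D'.darts :=
  h.flatMap_right _

theorem isClosed_congr {D D' : Diagram} (h : D.darts.Perm D'.darts) (hD : D.IsClosed) :
    D'.IsClosed :=
  ⟨h.nodup_iff.1 hD.1, fun x hx => h.mem_iff.1 (hD.2 x (h.mem_iff.2 hx))⟩

/-- Components are classes of the equivalence generated by strand steps, so a strand may be listed
in either direction. Corners carry an orientation and have to agree as ordered pairs. -/
theorem IsKnotDiagram.congr {D D' : Diagram} (hd : D.darts.Perm D'.darts)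
    (hl : D.length = D'.length)
    (hc : ∀ x y, (∃ p ∈ D, (x, y) ∈ p.corners) ↔ ∃ p ∈ D', (x, y) ∈ p.corners)
    (hs : ∀ x y, (∃ p ∈ D, (x, y) ∈ p.strands) →
      ∃ p ∈ D', (x, y) ∈ p.strands ∨ (y, x) ∈ p.strands)
    (hs' : ∀ x y, (∃ p ∈ D', (x, y) ∈ p.strands) →
      ∃ p ∈ D, (x, y) ∈ p.strands ∨ (y, x) ∈ p.strands)
    (hD : D.IsKnotDiagram) : D'.IsKnotDiagram := by
  have hcomp : ∀ {E E' : Diagram} (hd : E.darts.Perm E'.darts)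
      (hs : ∀ x y, (∃ p ∈ E, (x, y) ∈ p.strands) →
        ∃ p ∈ E', (x, y) ∈ p.strands ∨ (y, x) ∈ p.strands) (x y), E.StrandStep x y →
      Quot.mk E'.StrandStep ⟨x.1, hd.mem_iff.1 x.2⟩ =
        Quot.mk E'.StrandStep ⟨y.1, hd.mem_iff.1 y.2⟩ := by
    rintro E E' hd hs x y (h | h)
    · exact Quot.sound (.inl h)
    · obtain ⟨p, hp, h | h⟩ := hs _ _ h
      · exact Quot.sound (.inr ⟨p, hp, h⟩)
      · exact (Quot.sound (.inr ⟨p, hp, h⟩)).symm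
  have hface : ∀ {E E' : Diagram} (hd : E.darts.Perm E'.darts)
      (hc : ∀ x y, (∃ p ∈ E, (x, y) ∈ p.corners) → ∃ p ∈ E', (x, y) ∈ p.corners) (x y),
      E.FaceStep x y → Quot.mk E'.FaceStep ⟨x.1, hd.mem_iff.1 x.2⟩ =
        Quot.mk E'.FaceStep ⟨y.1, hd.mem_iff.1 y.2⟩ := by
    rintro E E' hd hc x y ⟨p, hp, h, hx, hy⟩
    obtain ⟨p', hp', hx'⟩ := hc _ _ ⟨p, hp, hx⟩
    exact Quot.sound ⟨p', hp', h, hx', hy⟩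
  refine ⟨isClosed_congr hd hD.closed, ?_, ?_⟩
  · rw [← hD.one_component]
    exact card_quot_subtype_eq (fun _ => hd.symm.mem_iff) (hcomp hd.symm hs') (hcomp hd hs)
  · have : D'.faceCount = D.faceCount :=
      card_quot_subtype_eq (fun _ => hd.symm.mem_iff) (hface hd.symm fun x y => (hc x y).2)
        (hface hd fun x y => (hc x y).1)
    rw [this, ← hl, ← hd.length_eq]
    exact hD.planar

theorem IsKnotDiagram.perm {D D' : Diagram} (h : D.Perm D') (hD : D.IsKnotDiagram) :
    D'.IsKnotDiagram :=
  hD.congr (darts_perm h) h.length_eq (by simp [h.mem_iff])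
    (fun x y ⟨p, hp, hx⟩ => ⟨p, h.mem_iff.1 hp, .inl hx⟩)
    (fun x y ⟨p, hp, hx⟩ => ⟨p, h.mem_iff.2 hp, .inl hx⟩)

theorem IsKnotDiagram.rotate {a b c d : Dart} {D : Diagram}
    (hD : IsKnotDiagram (.crossing a b c d :: D)) : IsKnotDiagram (.crossing c d a b :: D) := by
  refine hD.congr ?_ (by simp) ?_ ?_ ?_
  · exact (List.perm_append_comm (l₁ := [a, b]) (l₂ := [c, d])).append_right _
  · intro x y
    simp only [List.exists_mem_cons_iff, Piece.corners]
    refine or_congr ?_ Iff.rfl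
    simp
    tauto
  · intro x y
    simp only [List.exists_mem_cons_iff, Piece.strands]
    refine Or.imp ?_ fun ⟨p, hp, h⟩ => ⟨p, hp, .inl h⟩
    simp
    tauto
  · intro x y
    simp only [List.exists_mem_cons_iff, Piece.strands]
    refine Or.imp ?_ fun ⟨p, hp, h⟩ => ⟨p, hp, .inl h⟩
    simp
    tauto

theorem IsKnotDiagram.reverse {a b : Dart} {D : Diagram}
    (hD : IsKnotDiagram (.arc a b :: D)) : IsKnotDiagram (.arc b a :: D) := by
  refine hD.congr ?_ (by simp) ?_ ?_ ?_
  · exact (List.Perm.swap b a []).append_right _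
  · intro x y
    simp only [List.exists_mem_cons_iff, Piece.corners]
    refine or_congr ?_ Iff.rfl
    simp
    tauto
  · intro x y
    simp only [List.exists_mem_cons_iff, Piece.strands]
    refine Or.imp ?_ fun ⟨p, hp, h⟩ => ⟨p, hp, .inl h⟩
    simp
    tauto
  · intro x y
    simp only [List.exists_mem_cons_iff, Piece.strands]
    refine Or.imp ?_ fun ⟨p, hp, h⟩ => ⟨p, hp, .inl h⟩
    simp
    tauto

theorem IsKnotDiagram.rename {σ : Dart → Dart} (hσ : Function.Injective σ)
    (hflip : ∀ x, σ x.flip = (σ x).flip) {D : Diagram} (hD : D.IsKnotDiagram) :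
    IsKnotDiagram (D.map (Piece.map σ)) := by
  have hmem : ∀ x, σ x ∈ darts (D.map (Piece.map σ)) ↔ x ∈ D.darts := fun x => by
    rw [darts_map, List.mem_map_of_injective hσ]
  let e : {h // h ∈ D.darts} ≃ {h // h ∈ darts (D.map (Piece.map σ))} :=
    Equiv.ofBijective (fun x => ⟨σ x.1, (hmem _).2 x.2⟩) ⟨fun x y h => by
      simpa [Subtype.ext_iff, hσ.eq_iff] using h, fun ⟨y, hy⟩ => by
      have := hy
      rw [darts_map, List.mem_map] at this
      obtain ⟨x, hx, rfl⟩ := this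
      exact ⟨⟨x, hx⟩, rfl⟩⟩
  have he : ∀ x, (e x).1 = σ x.1 := fun _ => rfl
  refine ⟨⟨?_, ?_⟩, ?_, ?_⟩
  · rw [darts_map]; exact hD.closed.1.map hσ
  · intro h hh
    rw [darts_map, List.mem_map] at hh
    obtain ⟨x, hx, rfl⟩ := hh
    rw [← hflip, hmem]
    exact hD.closed.2 x hx
  · rw [← hD.one_component]
    refine Nat.card_congr (Quot.congr e fun x y => ?_).symm
    refine or_congr ?_ ?_
    · rw [he, he, ← hflip, hσ.eq_iff]
    · simp [he, Piece.strands_map, hσ.eq_iff]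
  · have : faceCount (D.map (Piece.map σ)) = D.faceCount := by
      refine Nat.card_congr (Quot.congr e fun x y => ?_).symm
      constructor
      · rintro ⟨p, hp, h, hx, hy⟩
        exact ⟨p.map σ, List.mem_map_of_mem hp, σ h, by
          rw [Piece.corners_map, he]; exact List.mem_map.2 ⟨_, hx, rfl⟩, by rw [he, hy, hflip]⟩
      · rintro ⟨p, hp, h, hx, hy⟩
        obtain ⟨p, hp', rfl⟩ := List.mem_map.1 hp
        rw [Piece.corners_map] at hx
        obtain ⟨⟨x', h'⟩, hx', hh⟩ := List.mem_map.1 hx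
        simp only [Prod.map_apply, Prod.mk.injEq, he, hσ.eq_iff] at hh
        obtain ⟨rfl, rfl⟩ := hh
        exact ⟨p, hp', h', hx', hσ (by rw [← he, hy, hflip])⟩
    rw [this, darts_map, List.length_map, List.length_map]
    exact hD.planar

/-- Smoothing loses one vertex and one edge and preserves the numbers of faces and components, so
the Euler characteristic stays. The equivalence is needed backwards as well: planarity of a diagram
with subdivision vertices is later inferred from its smoothing. -/
theorem isClosed_smooth_and_isKnotDiagram_smooth_iff {a b : Dart} (hab : b ≠ a.flip) {D : Diagram}
    (hc : IsClosed (.arc a b :: D)) :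
    IsClosed (D.map (Piece.map fun x => if x = b.flip then a else x)) ∧
    (IsKnotDiagram (.arc a b :: D) ↔
      IsKnotDiagram (D.map (Piece.map fun x => if x = b.flip then a else x))) := by
  set σ : Dart → Dart := fun x => if x = b.flip then a else x with hσ
  set D₀ : Diagram := .arc a b :: D with hD₀
  set D' : Diagram := D.map (Piece.map σ) with hD'
  obtain ⟨hnd, hfl⟩ := hc
  have hmem₀ : ∀ x, x ∈ D₀.darts ↔ x = a ∨ x = b ∨ x ∈ D.darts := fun x => by
    simp [hD₀, Piece.darts]
  have hnd' := hnd
  rw [hD₀, darts_cons] at hnd'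
  simp only [Piece.darts, List.cons_append, List.nil_append, List.nodup_cons, List.mem_cons,
    not_or] at hnd'
  obtain ⟨⟨hne, haD⟩, hbD, hndD⟩ := hnd'
  have hafD : a.flip ∈ D.darts := by
    rcases (hmem₀ _).1 (hfl a ((hmem₀ a).2 (.inl rfl))) with h | h | h
    · exact absurd h (by simp)
    · exact absurd h.symm hab
    · exact h
  have hbfD : b.flip ∈ D.darts := by
    rcases (hmem₀ _).1 (hfl b ((hmem₀ b).2 (.inr (.inl rfl)))) with h | h | h
    · exact absurd (Dart.flip_eq_iff.1 h) hab
    · exact absurd h (by simp)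
    · exact h
  have hσb : σ b.flip = a := if_pos rfl
  have hσn : ∀ x, x ≠ b.flip → σ x = x := fun x hx => if_neg hx
  have hσa : σ a.flip = a.flip := hσn _ (by simpa using hne)
  have hσD : ∀ x ∈ D.darts, σ x ∈ D'.darts := fun x hx => by
    rw [hD', darts_map]; exact List.mem_map_of_mem hx
  -- `a` does not occur in `D`, so in `D'` it can only come from `b.flip`; hence `τ` inverts `σ`.
  let τ : Dart → Dart := fun y => if y = a then b.flip else y
  have hτσ : ∀ x ∈ D.darts, τ (σ x) = x := by
    intro x hx
    by_cases h : x = b.flip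
    · subst h; rw [hσb]; exact if_pos rfl
    · rw [hσn x h]
      exact if_neg fun (h' : x = a) => haD (h' ▸ hx)
  have hD'mem : ∀ y, y ∈ D'.darts → ∃ x ∈ D.darts, σ x = y := fun y hy => by
    rwa [hD', darts_map, List.mem_map] at hy
  have hτD : ∀ y, y ∈ D'.darts → τ y ∈ D.darts := fun y hy => by
    obtain ⟨x, hx, rfl⟩ := hD'mem y hy
    rwa [hτσ x hx]
  have hστ : ∀ y, y ∈ D'.darts → σ (τ y) = y := fun y hy => by
    obtain ⟨x, hx, rfl⟩ := hD'mem y hy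
    rw [hτσ x hx]
  have haD' : a ∈ D'.darts := hσb ▸ hσD _ hbfD
  have hafD' : a.flip ∈ D'.darts := hσa ▸ hσD _ hafD
  -- the image of a dart of `D₀`
  let φ : Dart → Dart := fun x => if x = a then a else if x = b then a.flip else σ x
  have hφa : φ a = a := if_pos rfl
  have hφb : φ b = a.flip := by simp [φ, Ne.symm hne]
  have hφD : ∀ x ∈ D.darts, φ x = σ x := fun x hx => by
    have h1 : x ≠ a := fun h => haD (h ▸ hx)
    have h2 : x ≠ b := fun h => hbD (h ▸ hx)
    simp [φ, h1, h2]
  have hφmem : ∀ x, x ∈ D₀.darts → φ x ∈ D'.darts := by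
    intro x hx
    rcases (hmem₀ _).1 hx with rfl | rfl | h
    · rwa [hφa]
    · rwa [hφb]
    · rw [hφD x h]; exact hσD x h
  have hφflip : ∀ x ∈ D.darts, φ x.flip = (σ x).flip := by
    intro x hx
    by_cases h : x = b.flip
    · subst h; rw [Dart.flip_flip, hφb, hσb]
    · rw [hσn x h]
      rcases (hmem₀ _).1 (hfl x ((hmem₀ x).2 (.inr (.inr hx)))) with h' | h' | h'
      · rw [h', hφa]
      · exact absurd (Dart.flip_eq_iff.1 h') h
      · rw [hφD _ h', hσn]
        intro h''
        exact hbD (Dart.flip_inj.1 h'' ▸ hx)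
  have hclosed : D'.IsClosed := by
    constructor
    · rw [hD', darts_map]
      refine hndD.map_on fun x hx y hy h => ?_
      rw [← hτσ x hx, ← hτσ y hy, h]
    · intro y hy
      obtain ⟨x, hx, rfl⟩ := hD'mem y hy
      rw [← hφflip x hx]
      exact hφmem _ (hfl x ((hmem₀ x).2 (.inr (.inr hx))))
  have hτmem : ∀ y, y ∈ D'.darts → τ y ∈ D₀.darts := fun y hy =>
    (hmem₀ _).2 (.inr (.inr (hτD y hy)))
  -- counting the classes of a step relation
  have key : ∀ (r : {h // h ∈ D₀.darts} → {h // h ∈ D₀.darts} → Prop)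
      (r' : {h // h ∈ D'.darts} → {h // h ∈ D'.darts} → Prop),
      (∀ x y, r x y → Quot.mk r' ⟨φ x.1, hφmem _ x.2⟩ = Quot.mk r' ⟨φ y.1, hφmem _ y.2⟩) →
      (∀ x y, r' x y → Quot.mk r ⟨τ x.1, hτmem _ x.2⟩ = Quot.mk r ⟨τ y.1, hτmem _ y.2⟩) →
      (Quot.mk r ⟨b.flip, (hmem₀ _).2 (.inr (.inr hbfD))⟩ =
        Quot.mk r ⟨a, (hmem₀ _).2 (.inl rfl)⟩) →
      (Quot.mk r ⟨a.flip, (hmem₀ _).2 (.inr (.inr hafD))⟩ =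
        Quot.mk r ⟨b, (hmem₀ _).2 (.inr (.inl rfl))⟩) →
      Nat.card (Quot r) = Nat.card (Quot r') := by
    intro r r' h1 h2 h3 h4
    refine card_quot_eq (fun x => Quot.mk r' ⟨φ x.1, hφmem _ x.2⟩)
      (fun x => Quot.mk r ⟨τ x.1, hτmem _ x.2⟩) h1 h2 ?_ ?_
    · rintro ⟨x, hx⟩
      show Quot.mk r ⟨τ (φ x), _⟩ = _
      rcases (hmem₀ _).1 hx with rfl | rfl | h
      · rw [← h3]; congr 2; rw [hφa, ← hσb, hτσ _ hbfD]
      · rw [← h4]; congr 2; rw [hφb, ← hσa, hτσ _ hafD, hσa]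
      · congr 2; rw [hφD _ h, hτσ _ h]
    · rintro ⟨y, hy⟩
      show Quot.mk r' ⟨φ (τ y), _⟩ = _
      congr 2
      rw [hφD _ (hτD y hy), hστ y hy]
  have harc : Piece.arc a b ∈ D₀ := List.mem_cons_self
  have hface : D₀.faceCount = D'.faceCount := by
    have hba : D₀.FaceStep ⟨b, (hmem₀ _).2 (.inr (.inl rfl))⟩
        ⟨a.flip, (hmem₀ _).2 (.inr (.inr hafD))⟩ := ⟨_, harc, a, by simp [Piece.corners], rfl⟩
    have hab' : D₀.FaceStep ⟨a, (hmem₀ _).2 (.inl rfl)⟩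
        ⟨b.flip, (hmem₀ _).2 (.inr (.inr hbfD))⟩ := ⟨_, harc, b, by simp [Piece.corners], rfl⟩
    refine key _ _ ?_ ?_ (Quot.sound hab').symm (Quot.sound hba).symm
    · rintro ⟨x, hx⟩ ⟨y, hy⟩ ⟨p, hp, h, hxh, hyh⟩
      simp only at hxh hyh
      subst hyh
      rcases List.mem_cons.1 hp with rfl | hp
      · simp only [Piece.corners, List.mem_cons, Prod.mk.injEq, List.not_mem_nil, or_false] at hxh
        rcases hxh with ⟨rfl, rfl⟩ | ⟨rfl, rfl⟩
        · congr 2; rw [hφa, hφD _ hbfD, hσb]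
        · congr 2; rw [hφb, hφD _ hafD, hσa]
      · have hd := Piece.mem_darts_of_mem_corners hxh
        refine Quot.sound ⟨p.map σ, List.mem_map_of_mem hp, σ h, ?_, ?_⟩
        · show (φ x, σ h) ∈ _
          rw [Piece.corners_map, hφD x (mem_darts.2 ⟨p, hp, hd.1⟩)]
          exact List.mem_map.2 ⟨_, hxh, rfl⟩
        · exact hφflip h (mem_darts.2 ⟨p, hp, hd.2⟩)
    · rintro ⟨x, hx⟩ ⟨y, hy⟩ ⟨p, hp, h, hxh, hyh⟩
      simp only at hxh hyh
      subst hyh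
      obtain ⟨p, hp', rfl⟩ := List.mem_map.1 hp
      rw [Piece.corners_map] at hxh
      obtain ⟨⟨x', h'⟩, hxh', hh⟩ := List.mem_map.1 hxh
      simp only [Prod.map_apply, Prod.mk.injEq] at hh
      obtain ⟨rfl, rfl⟩ := hh
      have hd := Piece.mem_darts_of_mem_corners hxh'
      have hx' := mem_darts.2 ⟨p, hp', hd.1⟩
      have hh' := mem_darts.2 ⟨p, hp', hd.2⟩
      have hstep : D₀.FaceStep ⟨x', (hmem₀ _).2 (.inr (.inr hx'))⟩
          ⟨h'.flip, hfl _ ((hmem₀ _).2 (.inr (.inr hh')))⟩ :=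
        ⟨p, List.mem_cons_of_mem _ hp', h', hxh', rfl⟩
      have e1 : Quot.mk D₀.FaceStep ⟨τ (σ x'), hτmem _ hx⟩ =
          Quot.mk D₀.FaceStep ⟨x', (hmem₀ _).2 (.inr (.inr hx'))⟩ := by
        congr 2; exact hτσ _ hx'
      refine e1.trans ((Quot.sound hstep).trans ?_)
      by_cases hb : h' = b.flip
      · subst hb
        have : Quot.mk D₀.FaceStep ⟨b.flip.flip, hfl _ ((hmem₀ _).2 (.inr (.inr hh')))⟩ =
            Quot.mk D₀.FaceStep ⟨b, (hmem₀ _).2 (.inr (.inl rfl))⟩ := by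
          congr 2; simp
        rw [this, Quot.sound hba]
        congr 2
        show _ = τ (σ b.flip).flip
        rw [hσb, ← hσa, hτσ _ hafD, hσa]
      · by_cases ha : h'.flip = a
        · have : Quot.mk D₀.FaceStep ⟨h'.flip, hfl _ ((hmem₀ _).2 (.inr (.inr hh')))⟩ =
              Quot.mk D₀.FaceStep ⟨a, (hmem₀ _).2 (.inl rfl)⟩ := by congr 2
          rw [this, Quot.sound hab']
          congr 2
          show _ = τ (σ h').flip
          rw [hσn _ hb, ha]
          exact (if_pos rfl).symm
        · congr 2
          show _ = τ (σ h').flip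
          rw [hσn _ hb]
          exact (if_neg ha).symm
  have hcomp : D₀.componentCount = D'.componentCount := by
    have s1 : D₀.StrandStep ⟨a, (hmem₀ _).2 (.inl rfl)⟩ ⟨b, (hmem₀ _).2 (.inr (.inl rfl))⟩ :=
      .inr ⟨_, harc, by simp [Piece.strands]⟩
    have s2 : D₀.StrandStep ⟨a, (hmem₀ _).2 (.inl rfl)⟩
        ⟨a.flip, (hmem₀ _).2 (.inr (.inr hafD))⟩ := .inl rfl
    have s3 : D₀.StrandStep ⟨b, (hmem₀ _).2 (.inr (.inl rfl))⟩
        ⟨b.flip, (hmem₀ _).2 (.inr (.inr hbfD))⟩ := .inl rfl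
    have t : D'.StrandStep ⟨a, haD'⟩ ⟨a.flip, hafD'⟩ := .inl rfl
    refine key _ _ ?_ ?_ ((Quot.sound s1).trans (Quot.sound s3)).symm
      ((Quot.sound s2).symm.trans (Quot.sound s1))
    · rintro ⟨x, hx⟩ ⟨y, hy⟩ (hyx | ⟨p, hp, hxy⟩)
      · simp only at hyx
        subst hyx
        rcases (hmem₀ _).1 hx with rfl | rfl | h
        · refine Eq.trans ?_ ((Quot.sound t).trans ?_) <;> congr 2
          rw [hφD _ hafD, hσa]
        · refine Eq.trans ?_ ((Quot.sound t).symm.trans ?_) <;> congr 2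
          rw [hφD _ hbfD, hσb]
        · refine Quot.sound (.inl ?_)
          show φ x.flip = (φ x).flip
          rw [hφflip x h, hφD x h]
      · simp only at hxy
        rcases List.mem_cons.1 hp with rfl | hp
        · simp only [Piece.strands, List.mem_cons, Prod.mk.injEq, List.not_mem_nil,
            or_false] at hxy
          obtain ⟨rfl, rfl⟩ := hxy
          refine Eq.trans ?_ ((Quot.sound t).trans ?_) <;> congr 2
          exact hφb.symm
        · have hd := Piece.mem_darts_of_mem_strands hxy
          refine Quot.sound (.inr ⟨p.map σ, List.mem_map_of_mem hp, ?_⟩)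
          show (φ x, φ y) ∈ _
          rw [Piece.strands_map, hφD x (mem_darts.2 ⟨p, hp, hd.1⟩),
            hφD y (mem_darts.2 ⟨p, hp, hd.2⟩)]
          exact List.mem_map.2 ⟨_, hxy, rfl⟩
    · rintro ⟨x, hx⟩ ⟨y, hy⟩ (hyx | ⟨p, hp, hxy⟩)
      · simp only at hyx
        subst hyx
        have ha1 : τ a = b.flip := if_pos rfl
        have ha2 : τ a.flip = a.flip := if_neg (by simp)
        have e : Quot.mk D₀.StrandStep ⟨b.flip, (hmem₀ _).2 (.inr (.inr hbfD))⟩ =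
            Quot.mk D₀.StrandStep ⟨a.flip, (hmem₀ _).2 (.inr (.inr hafD))⟩ :=
          (Quot.sound s3).symm.trans ((Quot.sound s1).symm.trans (Quot.sound s2))
        by_cases h1 : x = a
        · subst h1
          refine Eq.trans ?_ (e.trans ?_) <;> congr 2
          exact ha2.symm
        · by_cases h2 : x.flip = a
          · obtain rfl := Dart.flip_eq_iff.1 h2
            refine Eq.trans ?_ (e.symm.trans ?_) <;> congr 2
            simp [ha1]
          · refine Quot.sound (.inl ?_)
            show τ x.flip = (τ x).flip
            simp [τ, h1, h2]
      · obtain ⟨p, hp', rfl⟩ := List.mem_map.1 hp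
        rw [Piece.strands_map] at hxy
        obtain ⟨⟨x', y'⟩, hxy', hh⟩ := List.mem_map.1 hxy
        simp only [Prod.map_apply, Prod.mk.injEq] at hh
        obtain ⟨rfl, rfl⟩ := hh
        have hd := Piece.mem_darts_of_mem_strands hxy'
        refine Quot.sound (.inr ⟨p, List.mem_cons_of_mem _ hp', ?_⟩)
        show (τ (σ x'), τ (σ y')) ∈ _
        rw [hτσ _ (mem_darts.2 ⟨p, hp', hd.1⟩), hτσ _ (mem_darts.2 ⟨p, hp', hd.2⟩)]
        exact hxy'
  have hlen : D₀.length = D'.length + 1 := by simp [hD₀, hD']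
  have hdl : D₀.darts.length = D'.darts.length + 2 := by
    rw [hD₀, hD', darts_map]; simp [Piece.darts]
  refine ⟨hclosed, ?_, ?_⟩
  · intro h
    refine ⟨hclosed, hcomp ▸ h.one_component, ?_⟩
    have := h.planar
    omega
  · intro h
    refine ⟨⟨hnd, hfl⟩, hcomp ▸ h.one_component, ?_⟩
    have := h.planar
    omega

end Diagram
end FreeKnot

/-! ### The foils are knot diagrams -/

namespace FreeKnot

/-- The crossing number `i` of the free twist, assigned with `b`. -/
def column (i : ℕ) (b : Bool) : Piece :=
  FreeCrossing.assign
    { a := (2 * i, true)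
      b := (2 * i + 1, true)
      c := (2 * (i + 1) + 1, false)
      d := (2 * (i + 1), false) } b

/-- The twist with assignment `w` whose leftmost crossing has number `k`. -/
def twist : ℕ → List Bool → Diagram
  | _, [] => []
  | k, b :: w => column k b :: twist (k + 1) w

/-- The closing arcs of the free `n`-foil. -/
def closingArcs (n : ℕ) : Diagram :=
  [.arc (0, false) (2 * n, true), .arc (1, false) (2 * n + 1, true)]

/-- The resultant of the free foil for the assignment listed in `w`. -/
def foil (w : List Bool) : Diagram := twist 0 w ++ closingArcs w.length

theorem twist_eq_ofFn (n k : ℕ) (s : Fin n → Bool) :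
    twist k (List.ofFn s) = List.ofFn fun i => column (k + i) (s i) := by
  induction n generalizing k with
  | zero => rfl
  | succ n ih =>
    rw [List.ofFn_succ, List.ofFn_succ, twist, ih]
    simp only [Fin.val_succ, Fin.val_zero, add_zero, List.cons.injEq, true_and]
    congr 1
    funext i
    congr 1
    omega

theorem resultant_freeFoil (n : ℕ) (s : Assignment n) :
    (freeFoil n).resultant s = foil (List.ofFn s) := by
  rw [foil, twist_eq_ofFn, List.length_ofFn]
  simp only [zero_add]
  rfl

theorem leftFoil_eq (k : ℕ) : leftFoil k = foil (List.replicate k true) := by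
  rw [leftFoil, resultant_freeFoil, List.ofFn_const]

theorem rightFoil_eq (k : ℕ) : rightFoil k = foil (List.replicate k false) := by
  rw [rightFoil, resultant_freeFoil, List.ofFn_const]

theorem twist_append (k : ℕ) (u v : List Bool) :
    twist k (u ++ v) = twist k u ++ twist (k + u.length) v := by
  induction u generalizing k with
  | nil => rfl
  | cons b u ih => simp [twist, ih, Nat.add_assoc, Nat.add_comm 1]

@[simp] theorem length_twist (k : ℕ) (w : List Bool) : (twist k w).length = w.length := by
  induction w generalizing k with
  | nil => rfl
  | cons b w ih => simp [twist, ih]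

theorem mem_darts_column {i : ℕ} {b : Bool} {x : Dart} : x ∈ (column i b).darts ↔
    x = (2 * i, true) ∨ x = (2 * i + 1, true) ∨ x = (2 * i + 3, false) ∨
      x = (2 * i + 2, false) := by
  cases b <;> simp [column, FreeCrossing.assign, Piece.darts, mul_add]
  tauto

theorem mem_corners_column {i : ℕ} {b : Bool} {q : Dart × Dart} : q ∈ (column i b).corners ↔
    q = ((2 * i, true), (2 * i + 1, true)) ∨ q = ((2 * i + 1, true), (2 * i + 3, false)) ∨
    q = ((2 * i + 3, false), (2 * i + 2, false)) ∨ q = ((2 * i + 2, false), (2 * i, true)) := by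
  cases b <;> simp [column, FreeCrossing.assign, Piece.corners, mul_add]
  tauto

theorem mem_strands_column (i : ℕ) (b : Bool) :
    (((2 * i, true), (2 * i + 3, false)) ∈ (column i b).strands ∨
      ((2 * i + 3, false), (2 * i, true)) ∈ (column i b).strands) ∧
    (((2 * i + 1, true), (2 * i + 2, false)) ∈ (column i b).strands ∨
      ((2 * i + 2, false), (2 * i + 1, true)) ∈ (column i b).strands) := by
  cases b <;> simp [column, FreeCrossing.assign, Piece.strands, mul_add]

theorem exists_column_mem_twist {k i : ℕ} {w : List Bool} (hi : i < w.length) :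
    ∃ b, column (k + i) b ∈ twist k w := by
  induction w generalizing k i with
  | nil => simp at hi
  | cons b w ih =>
    cases i with
    | zero => exact ⟨b, List.mem_cons_self⟩
    | succ i =>
      obtain ⟨b', hb'⟩ := ih (k := k + 1) (i := i) (by simpa using hi)
      exact ⟨b', List.mem_cons_of_mem _ (by rwa [add_right_comm] at hb')⟩

theorem mem_twist {k : ℕ} {w : List Bool} {p : Piece} (hp : p ∈ twist k w) :
    ∃ i < w.length, ∃ b, p = column (k + i) b := by
  induction w generalizing k with
  | nil => simp [twist] at hp
  | cons b w ih =>
    rcases List.mem_cons.1 hp with rfl | hp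
    · exact ⟨0, by simp, b, rfl⟩
    · obtain ⟨i, hi, b', rfl⟩ := ih hp
      exact ⟨i + 1, by simpa using hi, b', by congr 1; omega⟩

theorem mem_foil {w : List Bool} {p : Piece} (hp : p ∈ foil w) :
    (∃ i < w.length, ∃ b, p = column i b) ∨
      p = .arc (0, false) (2 * w.length, true) ∨ p = .arc (1, false) (2 * w.length + 1, true) := by
  rcases List.mem_append.1 hp with h | h
  · obtain ⟨i, hi, b, rfl⟩ := mem_twist h
    exact .inl ⟨i, hi, b, by rw [zero_add]⟩
  · right
    simpa [closingArcs] using h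

theorem exists_column_mem_foil {w : List Bool} {i : ℕ} (hi : i < w.length) :
    ∃ b, column i b ∈ foil w := by
  obtain ⟨b, hb⟩ := exists_column_mem_twist (k := 0) hi
  exact ⟨b, List.mem_append_left _ (by rwa [zero_add] at hb)⟩

theorem upper_arc_mem_foil (w : List Bool) : .arc (0, false) (2 * w.length, true) ∈ foil w :=
  List.mem_append_right _ (by simp [closingArcs])

theorem lower_arc_mem_foil (w : List Bool) : .arc (1, false) (2 * w.length + 1, true) ∈ foil w :=
  List.mem_append_right _ (by simp [closingArcs])

open Diagram

theorem length_darts_twist (k : ℕ) (w : List Bool) : (twist k w).darts.length = 4 * w.length := by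
  induction w generalizing k with
  | nil => rfl
  | cons b w ih =>
    rw [twist, darts_cons, List.length_append, ih, List.length_cons]
    cases b <;> simp [column, FreeCrossing.assign, Piece.darts] <;> omega

theorem length_darts_foil (w : List Bool) : (foil w).darts.length = 4 * w.length + 4 := by
  rw [foil, darts_append, List.length_append, length_darts_twist]
  rfl

theorem mem_darts_foil {w : List Bool} {x : Dart} :
    x ∈ (foil w).darts ↔ x.1 < 2 * w.length + 2 := by
  rw [mem_darts]
  constructor
  · rintro ⟨p, hp, hx⟩
    rcases mem_foil hp with ⟨i, hi, b, rfl⟩ | rfl | rfl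
    · rw [mem_darts_column] at hx
      rcases hx with rfl | rfl | rfl | rfl <;> simp only <;> omega
    · simp only [Piece.darts, List.mem_cons, List.not_mem_nil, or_false] at hx
      rcases hx with rfl | rfl <;> simp only <;> omega
    · simp only [Piece.darts, List.mem_cons, List.not_mem_nil, or_false] at hx
      rcases hx with rfl | rfl <;> simp only <;> omega
  · intro hx
    rcases x with ⟨e, _ | _⟩ <;> simp only at hx <;>
      obtain ⟨j, rfl | rfl⟩ := Nat.even_or_odd' e
    · rcases j with _ | j
      · exact ⟨_, upper_arc_mem_foil w, by simp [Piece.darts]⟩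
      · obtain ⟨b, hb⟩ := exists_column_mem_foil (w := w) (i := j) (by omega)
        exact ⟨_, hb, mem_darts_column.2 (by simp; omega)⟩
    · rcases j with _ | j
      · exact ⟨_, lower_arc_mem_foil w, by simp [Piece.darts]⟩
      · obtain ⟨b, hb⟩ := exists_column_mem_foil (w := w) (i := j) (by omega)
        exact ⟨_, hb, mem_darts_column.2 (by simp; omega)⟩
    · by_cases hj : j < w.length
      · obtain ⟨b, hb⟩ := exists_column_mem_foil hj
        exact ⟨_, hb, mem_darts_column.2 (by simp)⟩
      · obtain rfl : j = w.length := by omega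
        exact ⟨_, upper_arc_mem_foil w, by simp [Piece.darts]⟩
    · by_cases hj : j < w.length
      · obtain ⟨b, hb⟩ := exists_column_mem_foil hj
        exact ⟨_, hb, mem_darts_column.2 (by simp)⟩
      · obtain rfl : j = w.length := by omega
        exact ⟨_, lower_arc_mem_foil w, by simp [Piece.darts]⟩

theorem isClosed_foil (w : List Bool) : (foil w).IsClosed := by
  refine ⟨?_, fun x hx => mem_darts_foil.2 (by simpa using mem_darts_foil.1 hx)⟩
  have h : (foil w).darts.toFinset = Finset.range (2 * w.length + 2) ×ˢ Finset.univ := by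
    ext x
    simp [mem_darts_foil]
  -- The list has `4 * w.length + 4` entries and as many distinct members, so nothing is repeated.
  rw [← Multiset.coe_nodup, ← Multiset.toFinset_card_eq_card_iff_nodup]
  change (foil w).darts.toFinset.card = (foil w).darts.length
  rw [h, length_darts_foil]
  simp
  omega

/-- The face to which a corner of the free `n`-foil belongs. -/
def foilFace (n : ℕ) (x : Dart) : ℕ :=
  if x.1 % 2 = 0 then (if x.2 then (x.1 / 2) % n else n)
  else (if x.2 then n + 1 else (x.1 / 2) % n)

theorem faceCount_foil {w : List Bool} (hw : w ≠ []) : (foil w).faceCount = w.length + 2 := by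
  set n := w.length with hn
  have hn0 : 0 < n := List.length_pos_of_ne_nil hw
  have mem : ∀ {x : Dart}, x.1 < 2 * n + 2 → x ∈ (foil w).darts := mem_darts_foil.2
  have hlt : ∀ x, foilFace n x < n + 2 := fun x => by
    have := Nat.mod_lt (x.1 / 2) hn0
    unfold foilFace
    split_ifs <;> omega
  have hstep : ∀ x y, (foil w).FaceStep x y → foilFace n x.1 = foilFace n y.1 := by
    rintro ⟨x, hx⟩ ⟨y, hy⟩ ⟨p, hp, h, hxh, hyh⟩
    simp only at hxh hyh
    subst hyh
    have e1 : ∀ i, (2 * i + 1) / 2 = i := fun i => by omega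
    have e3 : ∀ i, (2 * i + 3) / 2 = i + 1 := fun i => by omega
    have m1 : ∀ i, (2 * i + 1) % 2 = 1 := fun i => by omega
    have m3 : ∀ i, (2 * i + 3) % 2 = 1 := fun i => by omega
    rcases mem_foil hp with ⟨i, hi, b, rfl⟩ | rfl | rfl
    · rw [mem_corners_column] at hxh
      simp only [Prod.mk.injEq] at hxh
      rcases hxh with ⟨rfl, rfl⟩ | ⟨rfl, rfl⟩ | ⟨rfl, rfl⟩ | ⟨rfl, rfl⟩ <;>
        simp [foilFace, Dart.flip, e1, e3, m1, m3]
    · simp only [Piece.corners, List.mem_cons, Prod.mk.injEq, List.not_mem_nil, or_false] at hxh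
      rcases hxh with ⟨rfl, rfl⟩ | ⟨rfl, rfl⟩ <;>
        simp [foilFace, Dart.flip, ← hn]
    · simp only [Piece.corners, List.mem_cons, Prod.mk.injEq, List.not_mem_nil, or_false] at hxh
      rcases hxh with ⟨rfl, rfl⟩ | ⟨rfl, rfl⟩ <;>
        simp [foilFace, Dart.flip, ← hn, e1, m1]
  let F : Quot (foil w).FaceStep → Fin (n + 2) :=
    Quot.lift (fun x => ⟨foilFace n x.1, hlt _⟩) fun x y h => Fin.ext (hstep x y h)
  -- every corner is joined to the chosen corner of its face
  obtain ⟨q, hqd⟩ : ∃ q : ∀ x : Dart, x.1 < 2 * n + 2 → Quot (foil w).FaceStep,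
      ∀ x hx, q x hx = Quot.mk _ ⟨x, mem hx⟩ := ⟨fun x hx => Quot.mk _ ⟨x, mem hx⟩, fun _ _ => rfl⟩
  have hq : ∀ x y hx hy, (∃ p ∈ foil w, ∃ h : Dart, (x, h) ∈ p.corners ∧ y = h.flip) →
      q x hx = q y hy := fun x y hx hy h => by
      rw [hqd, hqd]; exact Quot.sound h
  have top : ∀ j (hj : 2 * j < 2 * n + 2), q (2 * j, false) hj = q (0, false) (by simp) := by
    intro j
    induction j with
    | zero => intro _; rfl
    | succ j ih =>
      intro hj
      rw [← ih (by omega)]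
      obtain ⟨b, hb⟩ := exists_column_mem_foil (w := w) (i := j) (by omega)
      exact hq _ _ _ _ ⟨_, hb, (2 * j, true), mem_corners_column.2 (by simp [mul_add]), rfl⟩
  have bot : ∀ j (hj : 2 * j + 1 < 2 * n + 2),
      q (2 * j + 1, true) hj = q (1, true) (by simp) := by
    intro j
    induction j with
    | zero => intro _; rfl
    | succ j ih =>
      intro hj
      rw [← ih (by omega)]
      obtain ⟨b, hb⟩ := exists_column_mem_foil (w := w) (i := j) (by omega)
      exact (hq _ _ _ _ ⟨_, hb, (2 * j + 3, false), mem_corners_column.2 (by simp), rfl⟩).symm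
  -- The regions left of the first crossing and right of the last one are the same face, joined
  -- along the closing arc; hence the index modulo `n`.
  have midn : q (2 * n, true) (by simp) = q (0, true) (by simp) :=
    hq _ _ _ _ ⟨_, upper_arc_mem_foil w, (0, false), by simp [Piece.corners, ← hn], rfl⟩
  have midu : ∀ j (hj : 2 * j < 2 * n + 2),
      q (2 * j, true) hj = q (2 * (j % n), true) (by have := Nat.mod_lt j hn0; simp; omega) := by
    intro j hj
    by_cases h : j = n
    · subst h; simpa using midn
    · simp [Nat.mod_eq_of_lt (show j < n by omega)]
  have midl : ∀ j (hj : 2 * j + 1 < 2 * n + 2),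
      q (2 * j + 1, false) hj =
        q (2 * (j % n), true) (by have := Nat.mod_lt j hn0; simp; omega) := by
    intro j hj
    rw [← midu j (by omega)]
    by_cases h : j < n
    · obtain ⟨b, hb⟩ := exists_column_mem_foil (w := w) h
      exact (hq _ _ _ _ ⟨_, hb, (2 * j + 1, true), mem_corners_column.2 (by simp), rfl⟩).symm
    · obtain rfl : j = n := by omega
      rw [midn]
      have h1 : q (1, false) (by simp) = q (2 * n + 1, false) (by simp) :=
        hq _ _ _ _ ⟨_, lower_arc_mem_foil w, (2 * n + 1, true), by simp [Piece.corners, ← hn], rfl⟩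
      obtain ⟨b, hb⟩ := exists_column_mem_foil (w := w) hn0
      rw [← h1]
      exact (hq _ _ _ _ ⟨_, hb, (1, true), mem_corners_column.2 (by simp), rfl⟩).symm
  let G : Fin (n + 2) → Quot (foil w).FaceStep := fun i =>
    if h : i.1 < n then q (2 * i.1, true) (by simp; omega)
    else if i.1 = n then q (0, false) (by simp) else q (1, true) (by simp)
  have hGF : ∀ x, G (F x) = x := by
    rintro ⟨⟨⟨e, b⟩, hx⟩⟩
    have hx' := mem_darts_foil.1 hx
    simp only at hx'
    have hmod := fun j => Nat.mod_lt j hn0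
    show G ⟨foilFace n (e, b), hlt _⟩ = Quot.mk _ ⟨(e, b), mem hx'⟩
    rw [← hqd (e, b) hx']
    obtain ⟨j, rfl | rfl⟩ := Nat.even_or_odd' e
    · cases b
      · rw [top]; simp [G, foilFace]
      · rw [midu]; simp [G, foilFace, hmod]
    · have e1 : (2 * j + 1) / 2 = j := by omega
      cases b
      · rw [midl]; simp [G, foilFace, hmod, e1]
      · rw [bot]; simp [G, foilFace]
  have hFG : ∀ i, F (G i) = i := by
    rintro ⟨i, hi⟩
    by_cases h : i < n
    · simp [G, h, F, hqd, foilFace, Nat.mod_eq_of_lt h]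
    · by_cases h' : i = n
      · simp [G, h', F, hqd, foilFace]
      · obtain rfl : i = n + 1 := by omega
        simp [G, F, hqd, foilFace]
  rw [faceCount, Nat.card_congr ⟨F, G, hGF, hFG⟩, Nat.card_fin]

/-- Each crossing exchanges the upper and the lower level. After an odd number of crossings the
upper right end belongs to the strand that starts at the lower left, and the upper closing arc joins
it to the other strand. -/
theorem componentCount_foil {w : List Bool} (hw : Odd w.length) :
    (foil w).componentCount = 1 := by
  set n := w.length with hn
  obtain ⟨q, hqd⟩ : ∃ q : ∀ x : Dart, x.1 < 2 * n + 2 → Quot (foil w).StrandStep,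
      ∀ x hx, q x hx = Quot.mk _ ⟨x, mem_darts_foil.2 hx⟩ :=
    ⟨fun x hx => Quot.mk _ ⟨x, mem_darts_foil.2 hx⟩, fun _ _ => rfl⟩
  have hq : ∀ x y hx hy, (y = x.flip ∨ ∃ p ∈ foil w, (x, y) ∈ p.strands) →
      q x hx = q y hy := fun x y hx hy h => by
      rw [hqd, hqd]; exact Quot.sound h
  have hflip : ∀ e b hx, q (e, b) hx = q (e, true) hx := by
    intro e b hx
    cases b
    · exact hq _ _ _ _ (.inl rfl)
    · rfl
  have base : ∀ j, (∀ hj : 2 * j < 2 * n + 2,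
      q (2 * j, true) hj = q (if Even j then 0 else 1, true) (by split_ifs <;> simp)) ∧
      ∀ hj : 2 * j + 1 < 2 * n + 2,
      q (2 * j + 1, true) hj = q (if Even j then 1 else 0, true) (by split_ifs <;> simp) := by
    intro j
    induction j with
    | zero => simp
    | succ j ih =>
      constructor
      · intro hj
        obtain ⟨b, hb⟩ := exists_column_mem_foil (w := w) (i := j) (by omega)
        have e : q (2 * j + 1, true) (by simp; omega) = q (2 * j + 2, false) (by simp; omega) := by
          rcases (mem_strands_column j b).2 with h | h
          · exact hq _ _ _ _ (.inr ⟨_, hb, h⟩)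
          · exact (hq _ _ _ _ (.inr ⟨_, hb, h⟩)).symm
        have := hflip (2 * j + 2) false (by simp; omega)
        rw [← e, ih.2 (by omega)] at this
        simp only [mul_add, Nat.even_add_one, ite_not]
        exact this.symm
      · intro hj
        obtain ⟨b, hb⟩ := exists_column_mem_foil (w := w) (i := j) (by omega)
        have e : q (2 * j, true) (by simp; omega) = q (2 * j + 3, false) (by simp; omega) := by
          rcases (mem_strands_column j b).1 with h | h
          · exact hq _ _ _ _ (.inr ⟨_, hb, h⟩)
          · exact (hq _ _ _ _ (.inr ⟨_, hb, h⟩)).symm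
        have := hflip (2 * j + 3) false (by simp; omega)
        rw [← e, ih.1 (by omega)] at this
        simp only [mul_add, Nat.even_add_one, ite_not]
        exact this.symm
  have h01 : q (1, true) (by simp) = q (0, true) (by simp) := by
    have h1 := (base n).1 (by omega)
    simp only [Nat.not_even_iff_odd.2 hw, if_false] at h1
    rw [← h1, ← hflip 0 false (by simp)]
    exact (hq _ _ _ _ (.inr ⟨_, upper_arc_mem_foil w, by simp [Piece.strands, ← hn]⟩)).symm
  have all : ∀ x, x = q (0, true) (by simp) := by
    rintro ⟨⟨⟨e, b⟩, hx⟩⟩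
    have hx' := mem_darts_foil.1 hx
    rw [← hqd (e, b) hx', hflip _ _ hx']
    simp only [← hn] at hx'
    obtain ⟨j, rfl | rfl⟩ := Nat.even_or_odd' e
    · rw [(base j).1 hx']
      by_cases h : Even j
      · simp [h]
      · simp [h, h01]
    · rw [(base j).2 hx']
      by_cases h : Even j
      · simp [h, h01]
      · simp [h]
  rw [componentCount, Nat.card_eq_one_iff_exists]
  exact ⟨_, all⟩

theorem isKnotDiagram_foil {w : List Bool} (hw : Odd w.length) : (foil w).IsKnotDiagram := by
  refine ⟨isClosed_foil w, componentCount_foil hw, ?_⟩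
  rw [faceCount_foil (by rintro rfl; simp at hw), length_darts_foil]
  simp [foil, closingArcs]
  omega

end FreeKnot

/-! ### Cancelling neighbouring opposite crossings -/

namespace FreeKnot

theorem Piece.map_map (f g : Dart → Dart) (p : Piece) : (p.map f).map g = p.map (g ∘ f) := by
  cases p <;> rfl

theorem Piece.map_column_eq {f g : Dart → Dart} {i j : ℕ} (b : Bool)
    (h1 : f (2 * i, true) = g (2 * j, true)) (h2 : f (2 * i + 1, true) = g (2 * j + 1, true))
    (h3 : f (2 * i + 3, false) = g (2 * j + 3, false))
    (h4 : f (2 * i + 2, false) = g (2 * j + 2, false)) :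
    (column i b).map f = (column j b).map g := by
  cases b <;> simp [column, FreeCrossing.assign, Piece.map, mul_add, h1, h2, h3, h4]

namespace Diagram

/-- The darts before and after a second Reidemeister move. -/
theorem darts_reidemeisterII_perm (ul ur dl dr l r : Dart) (D : Diagram) :
    (darts (.crossing ur ul l r :: .crossing l.flip dl dr r.flip :: D)).Perm
      ([l, l.flip, r, r.flip] ++ darts (.arc ul dl :: .arc ur dr :: D)) := by
  simp only [darts_cons, Piece.darts, ← List.append_assoc]
  refine List.Perm.append_right _ ?_
  rw [← Multiset.coe_eq_coe]
  simp only [List.cons_append, List.nil_append, ← Multiset.cons_coe]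
  ext x
  simp only [Multiset.count_cons]
  omega

theorem IsClosed.of_perm_append {D D' : Diagram} {L : List Dart}
    (h : D.darts.Perm (L ++ D'.darts)) (hL : ∀ x ∈ L, x.flip ∈ L) (hD : D.IsClosed) :
    D'.IsClosed := by
  have hnd := h.nodup_iff.1 hD.1
  refine ⟨(List.nodup_append'.1 hnd).2.1, fun x hx => ?_⟩
  rcases List.mem_append.1 (h.mem_iff.1 (hD.2 x (h.mem_iff.2 (List.mem_append_right _ hx))))
    with h' | h'
  · have := hL _ h'
    rw [Dart.flip_flip] at this
    exact absurd hx ((List.nodup_append'.1 hnd).2.2 this)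
  · exact h'

theorem IsClosed.reidemeisterII {D D' : Diagram} (h : ReidemeisterII D D') (hD : D.IsClosed) :
    D'.IsClosed := by
  obtain ⟨ul, ur, dl, dr, l, r, D⟩ := h
  exact hD.of_perm_append (darts_reidemeisterII_perm ul ur dl dr l r D) (by simp)

theorem CancelsTo.of_isotopy {D D' : Diagram} (hD : D.IsKnotDiagram) (hD' : D'.IsKnotDiagram)
    (h : PlanarIsotopy D D') : CancelsTo D D' :=
  .single ⟨hD, hD', .inl h⟩

theorem CancelsTo.of_isotopy_symm {D D' : Diagram} (hD : D.IsKnotDiagram)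
    (hD' : D'.IsKnotDiagram) (h : PlanarIsotopy D' D) : CancelsTo D D' :=
  .single ⟨hD, hD', .inr (.inl h)⟩

theorem CancelsTo.of_reidemeisterII {D D' : Diagram} (hD : D.IsKnotDiagram)
    (hD' : D'.IsKnotDiagram) (h : ReidemeisterII D D') : CancelsTo D D' :=
  .single ⟨hD, hD', .inr (.inr h)⟩

theorem CancelsTo.of_perm {D D' : Diagram} (hD : D.IsKnotDiagram) (h : D.Perm D') :
    CancelsTo D D' :=
  .of_isotopy hD (hD.perm h) (.perm _ _ h)

theorem CancelsTo.rotate {a b c d : Dart} {D : Diagram}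
    (hD : IsKnotDiagram (.crossing a b c d :: D)) :
    CancelsTo (.crossing a b c d :: D) (.crossing c d a b :: D) :=
  .of_isotopy hD hD.rotate (.rotate ..)

theorem CancelsTo.reverse {a b : Dart} {D : Diagram}
    (hD : IsKnotDiagram (.arc a b :: D)) : CancelsTo (.arc a b :: D) (.arc b a :: D) :=
  .of_isotopy hD hD.reverse (.reverse ..)

end Diagram

open Diagram

/-- The names of the darts of a foil after the removal of the crossings number `i` and `i + 1`. -/
def skipTwo (i : ℕ) (x : Dart) : Dart := if x.1 < 2 * i + 2 then x else (x.1 + 4, x.2)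

theorem skipTwo_injective (i : ℕ) : Function.Injective (skipTwo i) := by
  rintro ⟨e, b⟩ ⟨e', b'⟩ h
  simp only [skipTwo] at h
  split_ifs at h <;> simp only [Prod.mk.injEq] at h ⊢ <;> refine ⟨?_, h.2⟩ <;> omega

theorem skipTwo_flip (i : ℕ) (x : Dart) : skipTwo i x.flip = (skipTwo i x).flip := by
  by_cases h : x.1 < 2 * i + 2 <;> simp [skipTwo, h, Dart.flip]

/-- The foil for `u ++ b :: !b :: v` without the crossings `b` and `!b`. -/
def foilRest (u v : List Bool) : Diagram :=
  twist 0 u ++ (twist (u.length + 2) v ++ closingArcs (u.length + 2 + v.length))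

theorem foil_perm (u v : List Bool) (b c : Bool) : (foil (u ++ b :: c :: v)).Perm
    (column u.length b :: column (u.length + 1) c :: foilRest u v) := by
  have hl : (u ++ b :: c :: v).length = u.length + 2 + v.length := by simp; omega
  rw [foil, twist_append, twist, twist, hl, zero_add, foilRest]
  simp only [List.append_assoc, List.cons_append]
  exact List.perm_middle.trans (List.perm_middle.cons _)

theorem map_twist_add_two {i : ℕ} {f g : Dart → Dart}
    (h : ∀ j b, i ≤ j → (column (j + 2) b).map f = (column j b).map g) (v : List Bool) (k : ℕ)
    (hk : i ≤ k) : (twist (k + 2) v).map (Piece.map f) = (twist k v).map (Piece.map g) := by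
  induction v generalizing k with
  | nil => rfl
  | cons b v ih =>
    rw [twist, twist, List.map_cons, List.map_cons, h _ _ hk, add_right_comm, ih _ (by omega)]

/-- The two smoothings glue the edges `2 * i + 4`, `2 * i + 5` right of the removed crossings onto
the edges `2 * i`, `2 * i + 1` left of them. The result is the shorter foil with a gap of four in
its edge names. -/
theorem map_foilRest (u v : List Bool) :
    ((foilRest u v).map (Piece.map fun x =>
        if x = Dart.flip (2 * u.length + 4, false) then (2 * u.length, true) else x)).map
      (Piece.map fun x =>
        if x = Dart.flip (2 * u.length + 5, false) then (2 * u.length + 1, true) else x) =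
    (foil (u ++ v)).map (Piece.map (skipTwo u.length)) := by
  rw [List.map_map]
  have hcomp : ∀ f g : Dart → Dart, Piece.map g ∘ Piece.map f = Piece.map (g ∘ f) := fun f g =>
    funext fun p => Piece.map_map f g p
  rw [hcomp, foilRest, foil, twist_append, List.append_assoc, List.map_append, List.map_append,
    List.map_append, List.map_append]
  set i := u.length
  set f : Dart → Dart := (fun x => if x = Dart.flip (2 * i + 5, false) then (2 * i + 1, true)
    else x) ∘ fun x => if x = Dart.flip (2 * i + 4, false) then (2 * i, true) else x with hf
  have f1 : ∀ e b, e < 2 * i + 2 → f (e, b) = skipTwo i (e, b) := by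
    intro e b he
    have h4 : e ≠ 2 * i + 4 := by omega
    have h5 : e ≠ 2 * i + 5 := by omega
    simp [hf, skipTwo, Dart.flip, he, h4, h5]
  have f2 : ∀ e b, 2 * i + 2 ≤ e → f (e + 4, b) = skipTwo i (e, b) := by
    intro e b he
    have h6 : e ≠ 2 * i := by omega
    have h7 : e ≠ 2 * i + 1 := by omega
    simp [hf, skipTwo, Dart.flip, he.not_gt, h6, h7]
  -- Right halves agree already from `2 * i` on, since the two glued edges keep the names of their
  -- left parts.
  have f3 : ∀ e, 2 * i ≤ e → f (e + 4, true) = skipTwo i (e, true) := by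
    intro e he
    by_cases h : 2 * i + 2 ≤ e
    · exact f2 e _ h
    · obtain rfl | rfl : e = 2 * i ∨ e = 2 * i + 1 := by omega
      · simp [hf, skipTwo, Dart.flip]
      · simp [hf, skipTwo, Dart.flip]
  congr 1
  · refine List.map_congr_left fun p hp => ?_
    obtain ⟨j, hj, b, rfl⟩ := mem_twist hp
    have hj' : 0 + j < i := by simpa using hj
    exact Piece.map_column_eq b (f1 _ _ (by omega)) (f1 _ _ (by omega)) (f1 _ _ (by omega))
      (f1 _ _ (by omega))
  · rw [zero_add]
    congr 1
    · refine map_twist_add_two (fun j b hj => ?_) v i le_rfl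
      exact Piece.map_column_eq b (f3 (2 * j) (by omega)) (f3 (2 * j + 1) (by show 2 * i ≤ 2 * j + 1; omega))
        (f2 (2 * j + 3) _ (by omega)) (f2 (2 * j + 2) _ (by omega))
    · have e1 : 2 * (i + 2 + v.length) = 2 * (i + v.length) + 4 := by ring
      have e2 : 2 * (i + v.length) + 4 + 1 = 2 * (i + v.length) + 1 + 4 := by ring
      simp only [closingArcs, List.map_cons, List.map_nil, Piece.map, List.length_append, e1, e2]
      rw [f1 0 _ (by omega), f1 1 _ (by omega), f3 _ (by omega), f3 _ (by omega)]

/-- One second Reidemeister move and two smoothings, up to renaming. Every diagram on the way has to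
be a planar knot diagram. Faces are not counted after the Reidemeister move: closedness survives it,
and being a knot diagram is carried back from the shorter foil through the smoothings. -/
theorem cancelsTo_foil_append {u v : List Bool} (b : Bool) (h : Odd (u ++ v).length) :
    CancelsTo (foil (u ++ b :: (!b) :: v)) (foil (u ++ v)) := by
  have hodd : Odd (u ++ b :: (!b) :: v).length := by
    have : (u ++ b :: (!b) :: v).length = (u ++ v).length + 2 := by simp; omega
    rw [this]
    exact h.add_even even_two
  set i := u.length with hi
  have k0 := isKnotDiagram_foil hodd
  have kend := (isKnotDiagram_foil h).rename (skipTwo_injective i) (skipTwo_flip i)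
  -- the diagram after the second Reidemeister move
  set E : Diagram := .arc (2 * i, true) (2 * i + 4, false) ::
    .arc (2 * i + 1, true) (2 * i + 5, false) :: foilRest u v with hE
  have kE : E.IsClosed → E.IsKnotDiagram ∧ CancelsTo E (foil (u ++ v)) := by
    intro hc
    obtain ⟨hc1, h1⟩ := isClosed_smooth_and_isKnotDiagram_smooth_iff (by simp [Dart.flip]) hc
    have eq1 : List.map (Piece.map fun x => if x = Dart.flip (2 * i + 4, false) then
        (2 * i, true) else x) (.arc (2 * i + 1, true) (2 * i + 5, false) :: foilRest u v) =
        .arc (2 * i + 1, true) (2 * i + 5, false) :: List.map (Piece.map fun x =>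
        if x = Dart.flip (2 * i + 4, false) then (2 * i, true) else x) (foilRest u v) := by
      have h1 : (2 * i + 1, true) ≠ Dart.flip (2 * i + 4, false) := by simp [Dart.flip]
      have h2 : (2 * i + 5, false) ≠ Dart.flip (2 * i + 4, false) := by simp [Dart.flip]
      rw [List.map_cons, Piece.map, if_neg h1, if_neg h2]
    have hab : ((2 * i + 5, false) : Dart) ≠ Dart.flip (2 * i + 1, true) := by simp [Dart.flip]
    have hab' : ((2 * i + 4, false) : Dart) ≠ Dart.flip (2 * i, true) := by simp [Dart.flip]
    have iso1 := PlanarIsotopy.smooth _ _ hab'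
      (.arc (2 * i + 1, true) (2 * i + 5, false) :: foilRest u v)
    rw [eq1] at hc1 h1 iso1
    obtain ⟨-, h2⟩ := isClosed_smooth_and_isKnotDiagram_smooth_iff hab hc1
    have iso2 := PlanarIsotopy.smooth _ _ hab (List.map (Piece.map fun x =>
        if x = Dart.flip (2 * i + 4, false) then (2 * i, true) else x) (foilRest u v))
    rw [map_foilRest] at h2 iso2
    have k2 := h2.2 kend
    have k1 := h1.2 k2
    exact ⟨k1, (CancelsTo.of_isotopy k1 k2 iso1).trans ((CancelsTo.of_isotopy k2 kend iso2).trans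
      (CancelsTo.of_isotopy_symm kend (isKnotDiagram_foil h)
        (.rename _ (skipTwo_injective i) (skipTwo_flip i) _)))⟩
  have p0 := foil_perm u v b (!b)
  refine (CancelsTo.of_perm k0 p0).trans ?_
  replace k0 := k0.perm p0
  cases b
  · -- rotate both crossings, the right one first
    have c1 := List.Perm.swap (column (i + 1) (!false)) (column i false) (foilRest u v)
    refine (CancelsTo.of_perm k0 c1).trans ?_
    replace k0 := k0.perm c1
    refine (CancelsTo.rotate k0).trans ?_
    replace k0 := IsKnotDiagram.rotate k0
    have c2 := List.Perm.swap (column i false) (.crossing (2 * (i + 2) + 1, false)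
      (2 * (i + 2), false) (2 * (i + 1), true) (2 * (i + 1) + 1, true)) (foilRest u v)
    refine (CancelsTo.of_perm k0 c2).trans ?_
    replace k0 := k0.perm c2
    refine (CancelsTo.rotate k0).trans ?_
    replace k0 := IsKnotDiagram.rotate k0
    have c3 := List.Perm.swap (.crossing (2 * (i + 2) + 1, false)
      (2 * (i + 2), false) (2 * (i + 1), true) (2 * (i + 1) + 1, true))
      (.crossing (2 * (i + 1), false) (2 * i, true) (2 * i + 1, true) (2 * (i + 1) + 1, false))
      (foilRest u v)
    refine (CancelsTo.of_perm k0 c3).trans ?_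
    replace k0 := k0.perm c3
    -- With the other sign the bigon matches the move only when read from its right end, so the
    -- resulting arcs run backwards and are reversed below.
    have r2 := ReidemeisterII.cancel (2 * (i + 2), false) (2 * (i + 2) + 1, false) (2 * i, true)
      (2 * i + 1, true) (2 * (i + 1), true) (2 * (i + 1) + 1, true) (foilRest u v)
    have hcE : E.IsClosed := by
      refine isClosed_congr ?_ (k0.closed.reidemeisterII r2)
      simp only [hE, darts_cons, Piece.darts]
      refine (List.Perm.swap _ _ _).trans (((List.Perm.swap _ _ _).cons _).cons _)
    obtain ⟨kE, cE⟩ := kE hcE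
    have kE1 := kE.reverse
    have kE2 := kE1.perm (List.Perm.swap _ _ _)
    have kE3 := kE2.reverse
    have kE4 := kE3.perm (List.Perm.swap _ _ _)
    refine (CancelsTo.of_reidemeisterII k0 kE4 r2).trans ?_
    refine (CancelsTo.of_perm kE4 (List.Perm.swap _ _ _)).trans ?_
    refine (CancelsTo.reverse kE3).trans ?_
    refine (CancelsTo.of_perm kE2 (List.Perm.swap _ _ _)).trans ?_
    exact (CancelsTo.reverse kE1).trans cE
  · have r2 := ReidemeisterII.cancel (2 * i + 1, true) (2 * i, true) (2 * (i + 2) + 1, false)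
      (2 * (i + 2), false) (2 * (i + 1) + 1, false) (2 * (i + 1), false) (foilRest u v)
    have hs : List.Perm _ E := List.Perm.swap _ _ (foilRest u v)
    have hcE : E.IsClosed := isClosed_congr (darts_perm hs) (k0.closed.reidemeisterII r2)
    obtain ⟨kE, cE⟩ := kE hcE
    exact (CancelsTo.of_reidemeisterII k0 (kE.perm hs.symm) r2).trans
      ((CancelsTo.of_perm (kE.perm hs.symm) hs).trans cE)

theorem eq_replicate_or_exists_append (w : List Bool) :
    (∃ b, w = List.replicate w.length b) ∨ ∃ u b v, w = u ++ b :: (!b) :: v := by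
  induction w with
  | nil => exact .inl ⟨true, rfl⟩
  | cons a w ih =>
    rcases ih with ⟨b, hb⟩ | ⟨u, b, v, rfl⟩
    · by_cases hab : a = b
      · subst hab
        exact .inl ⟨a, by rw [List.length_cons, List.replicate_succ, ← hb]⟩
      · cases w with
        | nil => exact .inl ⟨a, rfl⟩
        | cons c w =>
          have hc : c = b := by simpa [List.replicate_succ] using congrArg List.head? hb
          exact .inr ⟨[], a, w, by cases a <;> cases b <;> simp_all⟩
    · exact .inr ⟨a :: u, b, v, rfl⟩

/-- A cancelled pair contains one letter of each kind, so the excess of one letter over the other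
does not change. -/
theorem exists_cancelsTo_replicate (w : List Bool) (hw : Odd w.length) :
    ∃ k b, Odd k ∧ w.count b = w.count (!b) + k ∧
      CancelsTo (foil w) (foil (List.replicate k b)) := by
  induction hl : w.length using Nat.strong_induction_on generalizing w with
  | _ l ih =>
    rcases eq_replicate_or_exists_append w with ⟨b, hb⟩ | ⟨u, b, v, rfl⟩
    · refine ⟨w.length, b, hw, ?_, ?_⟩
      · conv_lhs => rw [hb]
        conv_rhs => rw [hb]
        simp [List.count_replicate]
      · rw [← hb]
        exact .refl
    · have hlen : (u ++ b :: (!b) :: v).length = (u ++ v).length + 2 := by simp; omega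
      have hodd : Odd (u ++ v).length := by
        rw [hlen] at hw
        exact (Nat.odd_add.1 hw).2 even_two
      obtain ⟨k, c, hk, hc, hcan⟩ := ih (u ++ v).length (by omega) (u ++ v) hodd rfl
      refine ⟨k, c, hk, ?_, (cancelsTo_foil_append b hodd).trans hcan⟩
      simp only [List.count_append, List.count_cons] at hc ⊢
      cases b <;> cases c <;> simp at hc ⊢ <;> omega

end FreeKnot

/-! ### Three-colour state sums and the local weight identities -/

namespace FreeKnot
/-- Summation of a function of edge colourings over the colours of the listed edges; all other
edges have colour `0`. -/
def sumList : List ℕ → ((ℕ → Fin 3) → ℝ) → ℝ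
  | [], f => f fun _ => 0
  | e :: l, f => sumList l fun c => ∑ v, f (Function.update c e v)

theorem sumList_perm {l l' : List ℕ} (h : l.Perm l') (f : (ℕ → Fin 3) → ℝ) :
    sumList l f = sumList l' f := by
  induction h generalizing f with
  | nil => rfl
  | cons e _ ih => exact ih _
  | trans _ _ ih₁ ih₂ => exact (ih₁ f).trans (ih₂ f)
  | swap e e' l =>
    simp only [sumList]
    congr 1
    funext c
    by_cases h : e = e'
    · subst h; rfl
    · rw [Finset.sum_comm]
      refine Finset.sum_congr rfl fun v _ => Finset.sum_congr rfl fun w _ => ?_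
      rw [Function.update_comm h]

/-- Summation over the colours of the edges in `S`. -/
noncomputable def sumOver (S : Finset ℕ) (f : (ℕ → Fin 3) → ℝ) : ℝ := sumList S.toList f

theorem sumOver_empty (f : (ℕ → Fin 3) → ℝ) : sumOver ∅ f = f fun _ => 0 := by
  simp [sumOver, sumList]

theorem sumOver_insert {e : ℕ} {S : Finset ℕ} (he : e ∉ S) (f : (ℕ → Fin 3) → ℝ) :
    sumOver (insert e S) f = sumOver S fun c => ∑ v, f (Function.update c e v) :=
  sumList_perm (Finset.toList_insert he) f

theorem sumOver_mul (S : Finset ℕ) (r : ℝ) (f : (ℕ → Fin 3) → ℝ) :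
    sumOver S (fun c => r * f c) = r * sumOver S f := by
  induction S using Finset.induction_on generalizing f with
  | empty => simp [sumOver_empty]
  | insert e S he ih => simp only [sumOver_insert he, ← Finset.mul_sum, ih]

theorem sumOver_image {τ : ℕ → ℕ} (hτ : Function.Injective τ) (S : Finset ℕ)
    (f : (ℕ → Fin 3) → ℝ) : sumOver (S.image τ) (fun c => f (c ∘ τ)) = sumOver S f := by
  induction S using Finset.induction_on generalizing f with
  | empty => simp only [Finset.image_empty, sumOver_empty]; rfl
  | insert e S he ih =>
    rw [Finset.image_insert, sumOver_insert (by simpa [hτ.eq_iff] using he), sumOver_insert he,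
      ← ih]
    simp only [Function.update_comp_eq_of_injective _ hτ]

/-- The Kronecker delta. -/
def delta (x y : Fin 3) : ℝ := if x = y then 1 else 0

theorem delta_comm (x y : Fin 3) : delta x y = delta y x := by simp [delta, eq_comm]

@[simp] theorem delta_self (x : Fin 3) : delta x x = 1 := if_pos rfl

theorem sum_delta_mul (x : Fin 3) (f : Fin 3 → ℝ) : ∑ v, delta x v * f v = f x := by
  simp [delta]

/-- The weight of a crossing whose darts have the given colours. -/
def crossingWeight (p q : ℝ) (a b c d : Fin 3) : ℝ :=
  p * (delta a b * delta c d) + q * (delta a d * delta b c)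

section Weights

variable {p q : ℝ}

theorem crossingWeight_rotate (a b c d : Fin 3) :
    crossingWeight p q c d a b = crossingWeight p q a b c d := by
  rw [crossingWeight, crossingWeight, delta_comm c b, delta_comm d a]
  ring

theorem sum_crossingWeight_snd (a c d : Fin 3) (f : Fin 3 → ℝ) :
    ∑ v, crossingWeight p q a v c d * f v = p * delta c d * f a + q * delta a d * f c := by
  rw [← sum_delta_mul a f, ← sum_delta_mul c f, Finset.mul_sum, Finset.mul_sum,
    ← Finset.sum_add_distrib]
  refine Finset.sum_congr rfl fun v _ => ?_
  rw [crossingWeight, delta_comm v c]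
  ring

theorem sum_crossingWeight_fth (a b c : Fin 3) (f : Fin 3 → ℝ) :
    ∑ v, crossingWeight p q a b c v * f v = p * delta a b * f c + q * delta b c * f a := by
  simp only [← crossingWeight_rotate a b, sum_crossingWeight_snd, delta_comm c b]

theorem cube_fst (hpq : p * q = -1) (hs : p ^ 2 + q ^ 2 = 3) : p ^ 3 = 3 * p + q := by
  linear_combination p * hs - q * hpq

theorem cube_snd (hpq : p * q = -1) (hs : p ^ 2 + q ^ 2 = 3) : q ^ 3 = p + 3 * q := by
  linear_combination q * hs - p * hpq

/-- One smoothing splits off a closed loop, worth `3`, and the other does not: `3 * p + q = p ^ 3`.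
-/
theorem sum_crossingWeight_kink_under (hpq : p * q = -1) (hs : p ^ 2 + q ^ 2 = 3) (b c : Fin 3) :
    ∑ v, crossingWeight p q v v b c = p ^ 3 * delta b c := by
  have h : ∀ v, crossingWeight p q v v b c = p * delta b c + q * (delta c v * delta v b) :=
    fun v => by rw [crossingWeight, delta_self, delta_comm v c]; ring
  simp only [h, Finset.sum_add_distrib, ← Finset.mul_sum, sum_delta_mul, delta_comm c b,
    cube_fst hpq hs, Finset.sum_const, Finset.card_univ, Fintype.card_fin, nsmul_eq_mul]
  push_cast
  ring

theorem sum_crossingWeight_kink_over (hpq : p * q = -1) (hs : p ^ 2 + q ^ 2 = 3) (b c : Fin 3) :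
    ∑ v, crossingWeight p q b v v c = q ^ 3 * delta b c := by
  have h : ∀ v, crossingWeight p q b v v c = q * delta b c + p * (delta b v * delta v c) :=
    fun v => by rw [crossingWeight, delta_self]; ring
  simp only [h, Finset.sum_add_distrib, ← Finset.mul_sum, sum_delta_mul,
    cube_snd hpq hs, Finset.sum_const, Finset.card_univ, Fintype.card_fin, nsmul_eq_mul]
  push_cast
  ring

/-- The unwanted connection has coefficient `p ^ 2 + q ^ 2 + 3 * p * q = 0` and the wanted one has
`p * q = -1`. A positive loop value is what forces the negative product: with `p * q = 1` it would
have to be `-(p ^ 2 + q ^ 2)`. -/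
theorem sum_crossingWeight_bigon (hpq : p * q = -1) (hs : p ^ 2 + q ^ 2 = 3)
    (ul ur dl dr : Fin 3) :
    ∑ l, ∑ r, crossingWeight p q ur ul l r * crossingWeight p q l dl dr r =
      -(delta ul dl * delta ur dr) := by
  have h1 : ∑ l, delta ul l * crossingWeight p q l dl dr ur = crossingWeight p q ul dl dr ur :=
    sum_delta_mul _ _
  have h2 : ∑ l, crossingWeight p q l dl dr l = q ^ 3 * delta dl dr := by
    have : ∀ l, crossingWeight p q l dl dr l = crossingWeight p q dl l l dr := fun l => by
      rw [crossingWeight, crossingWeight, delta_self, delta_comm dl l, delta_comm dr l]; ring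
    simp only [this, sum_crossingWeight_kink_over hpq hs]
  simp only [sum_crossingWeight_fth, Finset.sum_add_distrib, mul_assoc, ← Finset.mul_sum]
  rw [h1, h2, crossingWeight, delta_comm dr ur, delta_comm ur ul]
  linear_combination (delta ul dl * delta ur dr + q ^ 2 * delta ul ur * delta dl dr) * hpq

/-- Kauffman's argument: expand the crossing of the top and the middle strand on both sides. One
smoothing gives the same two-crossing picture on both sides; the other produces bigons, which the
second move removes. -/
theorem sum_crossingWeight_triangle_tmb (hpq : p * q = -1) (hs : p ^ 2 + q ^ 2 = 3)
    (t₁ t₂ m₁ m₂ b₁ b₂ : Fin 3) :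
    ∑ b, ∑ m, ∑ t, crossingWeight p q m₁ t m t₁ * crossingWeight p q b₁ t₂ b t *
        crossingWeight p q b m₂ b₂ m =
      ∑ b, ∑ m, ∑ t, crossingWeight p q b t b₂ t₁ * crossingWeight p q m t₂ m₂ t *
        crossingWeight p q b₁ m b m₁ := by
  have hl : ∀ b m, ∑ t, crossingWeight p q m₁ t m t₁ * crossingWeight p q b₁ t₂ b t *
        crossingWeight p q b m₂ b₂ m =
      p * (delta t₁ m * (crossingWeight p q b₁ t₂ b m₁ * crossingWeight p q b m₂ b₂ m)) +
      q * delta m₁ t₁ * (crossingWeight p q b₁ t₂ b m * crossingWeight p q b m₂ b₂ m) := by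
    intro b m
    simp only [mul_assoc, sum_crossingWeight_snd, delta_comm t₁ m]
  have hr : ∀ b m, ∑ t, crossingWeight p q b t b₂ t₁ * crossingWeight p q m t₂ m₂ t *
        crossingWeight p q b₁ m b m₁ =
      p * (delta t₂ m * (crossingWeight p q b m₂ b₂ t₁ * crossingWeight p q b₁ m b m₁)) +
      q * delta t₂ m₂ * (crossingWeight p q b₂ t₁ b m * crossingWeight p q b m₁ b₁ m) := by
    intro b m
    have : ∀ t, crossingWeight p q b t b₂ t₁ * crossingWeight p q m t₂ m₂ t *
        crossingWeight p q b₁ m b m₁ = crossingWeight p q m t₂ m₂ t *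
        (crossingWeight p q b t b₂ t₁ * crossingWeight p q b₁ m b m₁) := fun t => by ring
    simp only [this, sum_crossingWeight_fth, delta_comm t₂ m]
    rw [crossingWeight_rotate b m b₂ t₁, crossingWeight_rotate b₁ m b m₁]
    ring
  simp only [hl, hr, Finset.sum_add_distrib, ← Finset.mul_sum, sum_delta_mul,
    sum_crossingWeight_bigon hpq hs]
  rw [delta_comm t₁ m₁, delta_comm b₂ b₁]
  simp only [mul_comm (crossingWeight p q _ m₂ b₂ t₁)]
  ring

theorem sum_crossingWeight_triangle_tbm (hpq : p * q = -1) (hs : p ^ 2 + q ^ 2 = 3)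
    (t₁ t₂ m₁ m₂ b₁ b₂ : Fin 3) :
    ∑ b, ∑ m, ∑ t, crossingWeight p q b₁ t b t₁ * crossingWeight p q m₁ t₂ m t *
        crossingWeight p q b m b₂ m₂ =
      ∑ b, ∑ m, ∑ t, crossingWeight p q m t m₂ t₁ * crossingWeight p q b t₂ b₂ t *
        crossingWeight p q b₁ m₁ b m := by
  have hl : ∀ b m, ∑ t, crossingWeight p q b₁ t b t₁ * crossingWeight p q m₁ t₂ m t *
        crossingWeight p q b m b₂ m₂ =
      q * (delta t₂ m * (crossingWeight p q b₁ m₁ b t₁ * crossingWeight p q b m b₂ m₂)) +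
      p * delta m₁ t₂ * (crossingWeight p q b₂ m₂ b m * crossingWeight p q b t₁ b₁ m) := by
    intro b m
    have : ∀ t, crossingWeight p q b₁ t b t₁ * crossingWeight p q m₁ t₂ m t *
        crossingWeight p q b m b₂ m₂ = crossingWeight p q m₁ t₂ m t *
        (crossingWeight p q b₁ t b t₁ * crossingWeight p q b m b₂ m₂) := fun t => by ring
    simp only [this, sum_crossingWeight_fth]
    rw [crossingWeight_rotate b m b₂ m₂, crossingWeight_rotate b₁ m b t₁]
    ring
  have hr : ∀ b m, ∑ t, crossingWeight p q m t m₂ t₁ * crossingWeight p q b t₂ b₂ t *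
        crossingWeight p q b₁ m₁ b m =
      q * (delta t₁ m * (crossingWeight p q b t₂ b₂ m₂ * crossingWeight p q b₁ m₁ b m)) +
      p * delta m₂ t₁ * (crossingWeight p q b₁ m₁ b m * crossingWeight p q b t₂ b₂ m) := by
    intro b m
    simp only [mul_assoc, sum_crossingWeight_snd, delta_comm t₁ m]
    ring
  simp only [hl, hr, Finset.sum_add_distrib, ← Finset.mul_sum, sum_delta_mul,
    sum_crossingWeight_bigon hpq hs]
  rw [delta_comm b₂ b₁]
  simp only [mul_comm (crossingWeight p q _ t₂ b₂ m₂)]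
  ring

end Weights

end FreeKnot

/-! ### The partition function under isotopy and Reidemeister moves -/

namespace FreeKnot

/-- The weight of a vertex for an edge colouring. -/
def Piece.weight (p q : ℝ) (c : ℕ → Fin 3) : Piece → ℝ
  | .crossing x y z w => crossingWeight p q (c x.1) (c y.1) (c z.1) (c w.1)
  | .arc x y => delta (c x.1) (c y.1)

theorem Piece.weight_congr {p q : ℝ} {c c' : ℕ → Fin 3} {P : Piece}
    (h : ∀ x ∈ P.darts, c x.1 = c' x.1) : P.weight p q c = P.weight p q c' := by
  cases P <;> simp only [Piece.darts, List.mem_cons, List.not_mem_nil, or_false,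
    forall_eq_or_imp, forall_eq] at h <;> simp only [Piece.weight, h]

theorem Piece.weight_map {p q : ℝ} {c c' : ℕ → Fin 3} {σ : Dart → Dart} {P : Piece}
    (h : ∀ x ∈ P.darts, c (σ x).1 = c' x.1) : (P.map σ).weight p q c = P.weight p q c' := by
  cases P <;> simp only [Piece.darts, List.mem_cons, List.not_mem_nil, or_false,
    forall_eq_or_imp, forall_eq] at h <;> simp only [Piece.weight, Piece.map, h]

/-- The names of the edges to which the listed darts belong. -/
def edgeNames (L : List Dart) : Finset ℕ := (L.map Prod.fst).toFinset

theorem mem_edgeNames {L : List Dart} {e : ℕ} : e ∈ edgeNames L ↔ ∃ x ∈ L, x.1 = e := by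
  simp [edgeNames]

theorem fst_mem_edgeNames {L : List Dart} {x : Dart} (h : x ∈ L) : x.1 ∈ edgeNames L :=
  mem_edgeNames.2 ⟨x, h, rfl⟩

theorem edgeNames_perm {L L' : List Dart} (h : L.Perm L') : edgeNames L = edgeNames L' :=
  List.toFinset_eq_of_perm _ _ (h.map _)

theorem edgeNames_cons_cons_flip (x : Dart) (L : List Dart) :
    edgeNames (x :: x.flip :: L) = insert x.1 (edgeNames L) := by
  simp [edgeNames]

theorem fst_notMem_edgeNames {x : Dart} {L : List Dart} (h : (x :: x.flip :: L).Nodup) :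
    x.1 ∉ edgeNames L := by
  simp only [List.nodup_cons, List.mem_cons, not_or] at h
  intro hx
  obtain ⟨y, hy, hxy⟩ := mem_edgeNames.1 hx
  rcases Dart.fst_eq_iff.1 hxy with rfl | rfl
  · exact h.1.2 hy
  · exact h.2.1 hy

namespace Diagram

/-- The weight of a diagram for an edge colouring. -/
def weight (p q : ℝ) (D : Diagram) (c : ℕ → Fin 3) : ℝ := (D.map (Piece.weight p q c)).prod

/-- The partition function: the sum of the weights over all edge colourings. -/
noncomputable def partition (p q : ℝ) (D : Diagram) : ℝ :=
  sumOver (edgeNames D.darts) (D.weight p q)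

@[simp] theorem weight_cons (p q : ℝ) (P : Piece) (D : Diagram) (c : ℕ → Fin 3) :
    weight p q (P :: D) c = P.weight p q c * D.weight p q c := rfl

theorem weight_append (p q : ℝ) (D D' : Diagram) (c : ℕ → Fin 3) :
    weight p q (D ++ D') c = D.weight p q c * D'.weight p q c := by
  simp [weight]

theorem weight_map {p q : ℝ} {c c' : ℕ → Fin 3} {σ : Dart → Dart} {D : Diagram}
    (h : ∀ x ∈ D.darts, c (σ x).1 = c' x.1) :
    weight p q (D.map (Piece.map σ)) c = D.weight p q c' := by
  rw [weight, weight, List.map_map]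
  congr 1
  refine List.map_congr_left fun P hP => ?_
  exact Piece.weight_map fun x hx => h x (mem_darts.2 ⟨P, hP, hx⟩)

theorem weight_congr {p q : ℝ} {c c' : ℕ → Fin 3} {D : Diagram}
    (h : ∀ x ∈ D.darts, c x.1 = c' x.1) : D.weight p q c = D.weight p q c' := by
  rw [weight, weight]
  congr 1
  exact List.map_congr_left fun P hP => Piece.weight_congr fun x hx => h x (mem_darts.2 ⟨P, hP, hx⟩)

theorem weight_update {p q : ℝ} {c : ℕ → Fin 3} {D : Diagram} {e : ℕ} (v : Fin 3)
    (he : e ∉ edgeNames D.darts) :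
    D.weight p q (Function.update c e v) = D.weight p q c :=
  weight_congr fun x hx => Function.update_of_ne
    (fun h => he (by rw [← h]; exact fst_mem_edgeNames hx)) _ _

variable {p q : ℝ} {D D' : Diagram}

/-- Summing over the colour of the edge of `b` uses up the delta of the arc and gives that edge the
colour of the edge of `a`. -/
theorem partition_smooth {a b : Dart} (hab : b ≠ a.flip) (hc : IsClosed (.arc a b :: D)) :
    partition p q (D.map (Piece.map fun x => if x = b.flip then a else x)) =
      partition p q (.arc a b :: D) := by
  obtain ⟨hnd, hfl⟩ := hc
  simp only [darts_cons, Piece.darts, List.cons_append, List.nil_append, List.nodup_cons,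
    List.mem_cons, not_or] at hnd
  obtain ⟨⟨hne, haD⟩, hbD, -⟩ := hnd
  have hab1 : a.1 ≠ b.1 := fun h => by
    rcases Dart.fst_eq_iff.1 h with h | h
    · exact hne h
    · exact hab (Dart.flip_eq_iff.1 h.symm)
  have hbfD : b.flip ∈ D.darts := by
    have := hfl b (by simp [Piece.darts])
    simp only [darts_cons, Piece.darts, List.cons_append, List.nil_append, List.mem_cons] at this
    rcases this with h | h | h
    · exact absurd (Dart.flip_eq_iff.1 h) hab
    · exact absurd h (by simp)
    · exact h
  have hb : ∀ x ∈ D.darts, x ≠ b.flip → x.1 ≠ b.1 := fun x hx hxb h => by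
    rcases Dart.fst_eq_iff.1 h with rfl | h
    · exact hbD hx
    · exact hxb h
  have hE : edgeNames (darts (.arc a b :: D)) = insert b.1 (edgeNames
      (darts (D.map (Piece.map fun x => if x = b.flip then a else x)))) := by
    ext e
    simp only [mem_edgeNames, Finset.mem_insert, darts_map, darts_cons, Piece.darts, List.mem_map,
      List.cons_append, List.nil_append, List.mem_cons, exists_eq_or_imp]
    constructor
    · rintro (rfl | rfl | ⟨x, hx, rfl⟩)
      · exact .inr ⟨a, ⟨b.flip, hbfD, if_pos rfl⟩, rfl⟩
      · exact .inl rfl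
      · by_cases h : x = b.flip
        · subst h; exact .inl rfl
        · exact .inr ⟨x, ⟨x, hx, if_neg h⟩, rfl⟩
    · rintro (rfl | ⟨_, ⟨x, hx, rfl⟩, rfl⟩)
      · exact .inr (.inl rfl)
      · by_cases h : x = b.flip
        · exact .inl (by rw [if_pos h])
        · exact .inr (.inr ⟨x, hx, by rw [if_neg h]⟩)
  have hbE : b.1 ∉ edgeNames
      (darts (D.map (Piece.map fun x => if x = b.flip then a else x))) := by
    rw [mem_edgeNames]
    rintro ⟨y, hy, hyb⟩
    rw [darts_map, List.mem_map] at hy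
    obtain ⟨x, hx, rfl⟩ := hy
    by_cases h : x = b.flip
    · rw [if_pos h] at hyb; exact hab1 hyb
    · rw [if_neg h] at hyb; exact hb x hx h hyb
  rw [partition, partition, hE, sumOver_insert hbE]
  congr 1
  funext c
  simp only [weight_cons, Piece.weight, Function.update_self, Function.update_of_ne hab1,
    sum_delta_mul]
  refine weight_map fun x hx => ?_
  by_cases h : x = b.flip
  · subst h; simp
  · rw [if_neg h, Function.update_of_ne (hb x hx h)]

theorem partition_rename {σ : Dart → Dart} (hσ : Function.Injective σ)
    (hflip : ∀ x, σ x.flip = (σ x).flip) (D : Diagram) :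
    partition p q (D.map (Piece.map σ)) = D.partition p q := by
  have hτ : ∀ x : Dart, (σ x).1 = (σ (x.1, false)).1 := by
    rintro ⟨e, _ | _⟩
    · rfl
    · rw [show ((e, true) : Dart) = Dart.flip (e, false) from rfl, hflip]
      rfl
  have hinj : Function.Injective fun e => (σ (e, false)).1 := by
    intro e e' h
    rcases Dart.fst_eq_iff.1 h with h | h
    · exact congrArg Prod.fst (hσ h)
    · rw [← hflip] at h
      exact congrArg Prod.fst (hσ h)
  have hE : edgeNames (darts (D.map (Piece.map σ))) =
      (edgeNames D.darts).image fun e => (σ (e, false)).1 := by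
    ext e
    simp only [mem_edgeNames, Finset.mem_image, darts_map, List.mem_map]
    constructor
    · rintro ⟨_, ⟨x, hx, rfl⟩, rfl⟩
      exact ⟨x.1, ⟨x, hx, rfl⟩, (hτ x).symm⟩
    · rintro ⟨_, ⟨x, hx, rfl⟩, rfl⟩
      exact ⟨σ x, ⟨x, hx, rfl⟩, hτ x⟩
  rw [partition, partition, hE, ← sumOver_image hinj (edgeNames D.darts)]
  congr 1
  funext c
  exact weight_map fun x _ => congrArg c (hτ x)

theorem partition_planarIsotopy (hD : D.IsClosed) (h : PlanarIsotopy D D') :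
    D'.partition p q = D.partition p q := by
  induction h with
  | perm D D' h =>
    rw [partition, partition, edgeNames_perm (darts_perm h)]
    congr 1
    funext c
    exact ((h.map _).prod_eq).symm
  | rename σ hσ hflip D => exact partition_rename hσ hflip D
  | rotate a b c d D =>
    rw [partition, partition, edgeNames_perm (L' := darts (.crossing a b c d :: D))]
    · congr 1
      funext c'
      simp only [weight_cons, Piece.weight, crossingWeight_rotate (c' a.1)]
    · exact (List.perm_append_comm (l₁ := [c, d]) (l₂ := [a, b])).append_right _
  | reverse a b D =>
    rw [partition, partition, edgeNames_perm (L' := darts (.arc a b :: D))]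
    · congr 1
      funext c'
      simp only [weight_cons, Piece.weight, delta_comm (c' a.1)]
    · exact (List.Perm.swap a b []).append_right _
  | smooth a b hab D => exact partition_smooth hab hD

theorem partition_reidemeisterI (hpq : p * q = -1) (hs : p ^ 2 + q ^ 2 = 3) (hD : D.IsClosed)
    (h : ReidemeisterI D D') :
    D.partition p q = p ^ 3 * D'.partition p q ∨ D.partition p q = q ^ 3 * D'.partition p q := by
  -- Closedness ensures that the edge of the kink occurs nowhere else, so its colour can be summed
  -- out locally.
  have key : ∀ {x b c : Dart} {P : Piece} {D : Diagram} {r : ℝ}, IsClosed (P :: D) →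
      (darts (P :: D)).Perm (x :: x.flip :: darts (.arc b c :: D)) →
      (∀ f : ℕ → Fin 3, b.1 ≠ x.1 → c.1 ≠ x.1 → ∑ v, P.weight p q (Function.update f x.1 v) =
        r * delta (f b.1) (f c.1)) →
      partition p q (P :: D) = r * partition p q (.arc b c :: D) := by
    intro x b c P D r hD hperm hw
    have hx := fst_notMem_edgeNames (hperm.nodup_iff.1 hD.1)
    have hxb : b.1 ≠ x.1 := fun h => hx (h ▸ fst_mem_edgeNames (by simp [Piece.darts]))
    have hxc : c.1 ≠ x.1 := fun h => hx (h ▸ fst_mem_edgeNames (by simp [Piece.darts]))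
    have hxD : x.1 ∉ edgeNames D.darts := fun h => hx <| by
      obtain ⟨y, hy, hyx⟩ := mem_edgeNames.1 h
      exact mem_edgeNames.2 ⟨y, by simp [hy], hyx⟩
    rw [partition, partition, edgeNames_perm hperm, edgeNames_cons_cons_flip, sumOver_insert hx,
      ← sumOver_mul]
    congr 1
    funext f
    simp only [weight_cons, weight_update _ hxD, ← Finset.sum_mul, hw f hxb hxc]
    rw [Piece.weight, mul_assoc]
  cases h with
  | under_first x b c D =>
    refine .inl (key (x := x) hD (.refl _) fun f hb hc => ?_)
    simp only [Piece.weight, Dart.flip_fst, Function.update_self, Function.update_of_ne hb,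
      Function.update_of_ne hc, sum_crossingWeight_kink_under hpq hs]
  | over_first x b c D =>
    refine .inr (key (x := x) (b := b) (c := c) hD ?_ fun f hb hc => ?_)
    · exact (List.perm_append_comm (l₁ := [b]) (l₂ := [x, x.flip])).append_right _
    · simp only [Piece.weight, Dart.flip_fst, Function.update_self, Function.update_of_ne hb,
        Function.update_of_ne hc, sum_crossingWeight_kink_over hpq hs]

theorem partition_reidemeisterII (hpq : p * q = -1) (hs : p ^ 2 + q ^ 2 = 3) (hD : D.IsClosed)
    (h : ReidemeisterII D D') : D.partition p q = -D'.partition p q := by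
  obtain ⟨ul, ur, dl, dr, l, r, D⟩ := h
  have hperm := darts_reidemeisterII_perm ul ur dl dr l r D
  set L := darts (.arc ul dl :: .arc ur dr :: D) with hL
  have hnd := hperm.nodup_iff.1 hD.1
  have hl : l.1 ∉ edgeNames (r :: r.flip :: L) := fst_notMem_edgeNames hnd
  have hr : r.1 ∉ edgeNames L := fst_notMem_edgeNames (hnd.sublist (by simp))
  have hrl : r.1 ≠ l.1 := fun h => hl (h ▸ fst_mem_edgeNames (by simp))
  have hl' : l.1 ∉ edgeNames L := fun h => hl <| by
    rw [edgeNames_cons_cons_flip]; exact Finset.mem_insert_of_mem h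
  have hnl : ∀ x ∈ L, x.1 ≠ l.1 := fun x hx h => hl' (h ▸ fst_mem_edgeNames hx)
  have hnr : ∀ x ∈ L, x.1 ≠ r.1 := fun x hx h => hr (h ▸ fst_mem_edgeNames hx)
  have hE : edgeNames ([l, l.flip, r, r.flip] ++ L) = insert l.1 (insert r.1 (edgeNames L)) := by
    rw [← edgeNames_cons_cons_flip, ← edgeNames_cons_cons_flip]; rfl
  have hlD : l.1 ∉ edgeNames D.darts := fun h => by
    obtain ⟨y, hy, hyx⟩ := mem_edgeNames.1 h
    exact hnl y (by simp [hL, hy]) hyx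
  have hrD : r.1 ∉ edgeNames D.darts := fun h => by
    obtain ⟨y, hy, hyx⟩ := mem_edgeNames.1 h
    exact hnr y (by simp [hL, hy]) hyx
  rw [partition, partition, edgeNames_perm hperm, hE,
    sumOver_insert (by rwa [← edgeNames_cons_cons_flip]), sumOver_insert hr, ← hL,
    ← neg_one_mul (sumOver _ _), ← sumOver_mul]
  congr 1
  funext f
  have hout : ∀ x ∈ L, ∀ v v' : Fin 3,
      Function.update (Function.update f r.1 v') l.1 v x.1 = f x.1 := fun x hx v v' => by
    rw [Function.update_of_ne (hnl x hx), Function.update_of_ne (hnr x hx)]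
  have hul := hout ul (by simp [hL, Piece.darts])
  have hur := hout ur (by simp [hL, Piece.darts])
  have hdl := hout dl (by simp [hL, Piece.darts])
  have hdr := hout dr (by simp [hL, Piece.darts])
  simp only [weight_cons, weight_update _ hlD, weight_update _ hrD, Piece.weight, Dart.flip_fst,
    hul, hur, hdl, hdr, Function.update_self, Function.update_of_ne hrl, ← mul_assoc,
    ← Finset.sum_mul]
  rw [Finset.sum_comm, sum_crossingWeight_bigon hpq hs]
  ring

theorem partition_reidemeisterIII (hpq : p * q = -1) (hs : p ^ 2 + q ^ 2 = 3) (hD : D.IsClosed)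
    (h : ReidemeisterIII D D') : D.partition p q = D'.partition p q := by
  -- The colouring `f x y z` gives the inner edges `b`, `m`, `t` the colours `x`, `y`, `z` and is
  -- fixed on the six outer darts, so the claim reduces to one triangle identity.
  have key : ∀ {t₁ t₂ m₁ m₂ b₁ b₂ t m b : Dart} {P Q R P' Q' R' : Piece} {D : Diagram},
      IsClosed (P :: Q :: R :: D) →
      (P.darts ++ Q.darts ++ R.darts).Perm
        [t, t.flip, m, m.flip, b, b.flip, t₁, t₂, m₁, m₂, b₁, b₂] →
      (P'.darts ++ Q'.darts ++ R'.darts).Perm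
        [t, t.flip, m, m.flip, b, b.flip, t₁, t₂, m₁, m₂, b₁, b₂] →
      (∀ f : Fin 3 → Fin 3 → Fin 3 → ℕ → Fin 3, (∀ x y z, f x y z t.1 = z) →
        (∀ x y z, f x y z m.1 = y) → (∀ x y z, f x y z b.1 = x) →
        (∀ a ∈ [t₁, t₂, m₁, m₂, b₁, b₂], ∀ x y z, f x y z a.1 = f 0 0 0 a.1) →
        ∑ x, ∑ y, ∑ z, P.weight p q (f x y z) * Q.weight p q (f x y z) * R.weight p q (f x y z) =
        ∑ x, ∑ y, ∑ z,
          P'.weight p q (f x y z) * Q'.weight p q (f x y z) * R'.weight p q (f x y z)) →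
      partition p q (P :: Q :: R :: D) = partition p q (P' :: Q' :: R' :: D) := by
    intro t₁ t₂ m₁ m₂ b₁ b₂ t m b P Q R P' Q' R' D hD h1 h2 hw
    set L := [t₁, t₂, m₁, m₂, b₁, b₂] ++ D.darts with hL
    have hp1 : (darts (P :: Q :: R :: D)).Perm
        (t :: t.flip :: m :: m.flip :: b :: b.flip :: L) := by
      simpa [hL] using h1.append_right D.darts
    have hp2 : (darts (P' :: Q' :: R' :: D)).Perm
        (t :: t.flip :: m :: m.flip :: b :: b.flip :: L) := by
      simpa [hL] using h2.append_right D.darts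
    have hnd := hp1.nodup_iff.1 hD.1
    have ht := fst_notMem_edgeNames hnd
    have hm := fst_notMem_edgeNames (hnd.sublist (by simp) : (m :: m.flip :: b :: b.flip :: L).Nodup)
    have hb := fst_notMem_edgeNames 
      (hnd.sublist (List.sublist_append_right [t, t.flip, m, m.flip] _))
    simp only [edgeNames_cons_cons_flip] at ht hm
    have ht' := ht
    have hm' := hm
    simp only [Finset.mem_insert, not_or] at ht' hm'
    have hLE : ∀ x ∈ L, x.1 ≠ t.1 ∧ x.1 ≠ m.1 ∧ x.1 ≠ b.1 := fun x hx =>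
      ⟨fun h => ht'.2.2 (h ▸ fst_mem_edgeNames hx), fun h => hm'.2 (h ▸ fst_mem_edgeNames hx),
        fun h => hb (h ▸ fst_mem_edgeNames hx)⟩
    have hDL : ∀ x ∈ D.darts, x ∈ L := fun x hx => List.mem_append_right _ hx
    rw [partition, partition, edgeNames_perm hp1, edgeNames_perm hp2]
    simp only [edgeNames_cons_cons_flip]
    rw [sumOver_insert ht, sumOver_insert hm, sumOver_insert hb, sumOver_insert ht,
      sumOver_insert hm, sumOver_insert hb]
    congr 1
    funext c
    have hupd : ∀ u ∈ L, ∀ x y z, Function.update (Function.update (Function.update c b.1 x) m.1 y)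
        t.1 z u.1 = c u.1 := fun u hu x y z => by
      rw [Function.update_of_ne (hLE u hu).1, Function.update_of_ne (hLE u hu).2.1,
        Function.update_of_ne (hLE u hu).2.2]
    have hDw : ∀ x y z, D.weight p q (Function.update (Function.update (Function.update c b.1 x)
        m.1 y) t.1 z) = D.weight p q c := fun x y z =>
      weight_congr fun u hu => hupd u (hDL u hu) x y z
    simp only [weight_cons, hDw, ← mul_assoc, ← Finset.sum_mul]
    congr 1
    refine hw (fun x y z => Function.update (Function.update (Function.update c b.1 x) m.1 y)
        t.1 z) ?_ ?_ ?_ ?_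
    · intro x y z; rw [Function.update_self]
    · intro x y z; rw [Function.update_of_ne (Ne.symm ht'.1), Function.update_self]
    · intro x y z
      rw [Function.update_of_ne (Ne.symm ht'.2.1), Function.update_of_ne (Ne.symm hm'.1),
        Function.update_self]
    · intro u hu x y z
      rw [hupd u (List.mem_append_left _ hu), hupd u (List.mem_append_left _ hu)]
  cases h with
  | tmb t₁ t₂ m₁ m₂ b₁ b₂ t m b D =>
    refine key (t₁ := t₁) (t₂ := t₂) (m₁ := m₁) (m₂ := m₂) (b₁ := b₁) (b₂ := b₂) (t := t) (m := m)
      (b := b) hD ?_ ?_ fun f ht hm hb ho => ?_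
    · simp only [Piece.darts, List.cons_append, List.nil_append]
      rw [List.perm_iff_count]
      intro x
      simp only [List.count_cons, List.count_nil]
      omega
    · simp only [Piece.darts, List.cons_append, List.nil_append]
      rw [List.perm_iff_count]
      intro x
      simp only [List.count_cons, List.count_nil]
      omega
    · simp only [List.mem_cons, List.not_mem_nil, or_false, forall_eq_or_imp, forall_eq] at ho
      obtain ⟨h1, h2, h3, h4, h5, h6⟩ := ho
      simp only [Piece.weight, Dart.flip_fst, ht, hm, hb, h1, h2, h3, h4, h5, h6]
      exact sum_crossingWeight_triangle_tmb hpq hs ..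
  | tbm t₁ t₂ m₁ m₂ b₁ b₂ t m b D =>
    refine key (t₁ := t₁) (t₂ := t₂) (m₁ := m₁) (m₂ := m₂) (b₁ := b₁) (b₂ := b₂) (t := t) (m := m)
      (b := b) hD ?_ ?_ fun f ht hm hb ho => ?_
    · simp only [Piece.darts, List.cons_append, List.nil_append]
      rw [List.perm_iff_count]
      intro x
      simp only [List.count_cons, List.count_nil]
      omega
    · simp only [Piece.darts, List.cons_append, List.nil_append]
      rw [List.perm_iff_count]
      intro x
      simp only [List.count_cons, List.count_nil]
      omega
    · simp only [List.mem_cons, List.not_mem_nil, or_false, forall_eq_or_imp, forall_eq] at ho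
      obtain ⟨h1, h2, h3, h4, h5, h6⟩ := ho
      simp only [Piece.weight, Dart.flip_fst, ht, hm, hb, h1, h2, h3, h4, h5, h6]
      exact sum_crossingWeight_triangle_tbm hpq hs ..

end Diagram
end FreeKnot

/-! ### Evaluation on the foils -/

namespace FreeKnot
open Diagram

theorem weight_column (p q : ℝ) (i : ℕ) (b : Bool) (c : ℕ → Fin 3) :
    (column i b).weight p q c =
      (if b then q else p) * (delta (c (2 * i)) (c (2 * i + 2)) *
        delta (c (2 * i + 1)) (c (2 * i + 3))) +
      (if b then p else q) * (delta (c (2 * i)) (c (2 * i + 1)) *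
        delta (c (2 * i + 2)) (c (2 * i + 3))) := by
  cases b
  · simp only [column, FreeCrossing.assign, Piece.weight, crossingWeight, mul_add, if_false,
      Bool.false_eq_true]
    rw [delta_comm (c (2 * i + 2 * 1)) (c (2 * i)),
      delta_comm (c (2 * i + 2 * 1 + 1)) (c (2 * i + 2 * 1)), delta_comm (c (2 * i + 1)) (c (2 * i))]
    ring
  · simp only [column, FreeCrossing.assign, Piece.weight, crossingWeight, mul_add, if_true]
    rw [delta_comm (c (2 * i + 2 * 1 + 1)) (c (2 * i + 2 * 1))]
    ring

/-- Summing over the edges of a twist with equal crossings: the transfer matrix of a crossing is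
`α + β P`, where `P` is three times a projection. -/
theorem sumOver_twist_replicate {p q α β : ℝ} {b : Bool} (hα : α = if b then q else p)
    (hβ : β = if b then p else q) (n : ℕ) (G : Fin 3 → Fin 3 → Fin 3 → Fin 3 → ℝ) :
    sumOver (Finset.range (2 * n + 2)) (fun c => weight p q (twist 0 (List.replicate n b)) c *
        G (c 0) (c 1) (c (2 * n)) (c (2 * n + 1))) =
      α ^ n * ∑ x, ∑ y, G x y x y +
        ((α + 3 * β) ^ n - α ^ n) / 3 * ∑ x, ∑ y, G x x y y := by
  induction n generalizing G with
  | zero =>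
    have h2 : Finset.range (2 * 0 + 2) = insert 1 (insert 0 ∅) := by decide
    rw [h2, sumOver_insert (by simp), sumOver_insert (by simp), sumOver_empty]
    simp [twist, weight, Function.update_of_ne]
  | succ n ih =>
    have hr : Finset.range (2 * (n + 1) + 2) =
        insert (2 * n + 3) (insert (2 * n + 2) (Finset.range (2 * n + 2))) := by
      rw [← Finset.range_add_one, ← Finset.range_add_one]
      congr 1
    -- Summing out the two rightmost edges absorbs the last crossing into the test function `G` of
    -- the end colours.
    have hstep : ∀ c : ℕ → Fin 3, (∑ u, ∑ v,
        weight p q (twist 0 (List.replicate (n + 1) b))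
          (Function.update (Function.update c (2 * n + 2) u) (2 * n + 3) v) *
        G (Function.update (Function.update c (2 * n + 2) u) (2 * n + 3) v 0)
          (Function.update (Function.update c (2 * n + 2) u) (2 * n + 3) v 1)
          (Function.update (Function.update c (2 * n + 2) u) (2 * n + 3) v (2 * (n + 1)))
          (Function.update (Function.update c (2 * n + 2) u) (2 * n + 3) v (2 * (n + 1) + 1))) =
        weight p q (twist 0 (List.replicate n b)) c *
          (α * G (c 0) (c 1) (c (2 * n)) (c (2 * n + 1)) +
            β * (delta (c (2 * n)) (c (2 * n + 1)) * ∑ u, G (c 0) (c 1) u u)) := by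
      intro c
      have hc : ∀ e, e < 2 * n + 2 → ∀ u v,
          Function.update (Function.update c (2 * n + 2) u) (2 * n + 3) v e = c e := by
        intro e he u v
        rw [Function.update_of_ne (by omega), Function.update_of_ne (by omega)]
      have h2 : ∀ u v, Function.update (Function.update c (2 * n + 2) u) (2 * n + 3) v
          (2 * n + 2) = u := by
        intro u v
        rw [Function.update_of_ne (by omega), Function.update_self]
      have h3 : ∀ u v, Function.update (Function.update c (2 * n + 2) u) (2 * n + 3) v
          (2 * n + 3) = v := fun u v => Function.update_self ..
      have hW : ∀ u v, weight p q (twist 0 (List.replicate n b))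
          (Function.update (Function.update c (2 * n + 2) u) (2 * n + 3) v) =
          weight p q (twist 0 (List.replicate n b)) c := by
        intro u v
        refine weight_congr fun x hx => hc _ ?_ u v
        have : x ∈ (foil (List.replicate n b)).darts := by
          rw [foil, darts_append]
          exact List.mem_append_left _ hx
        simpa using mem_darts_foil.1 this
      simp only [List.replicate_succ', twist_append, weight_append, twist, weight_cons,
        List.length_replicate, zero_add, weight_column, hW, h2, h3, hc 0 (by omega),
        hc 1 (by omega), hc (2 * n) (by omega), hc (2 * n + 1) (by omega),
        show 2 * (n + 1) = 2 * n + 2 by ring, ← hα, ← hβ]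
      have e1 : ∑ u, ∑ v, α * (delta (c (2 * n)) u * (delta (c (2 * n + 1)) v *
          G (c 0) (c 1) u v)) = α * G (c 0) (c 1) (c (2 * n)) (c (2 * n + 1)) := by
        simp only [← Finset.mul_sum, sum_delta_mul]
      have e2 : ∑ u, ∑ v, β * (delta (c (2 * n)) (c (2 * n + 1)) * (delta u v *
          G (c 0) (c 1) u v)) = β * (delta (c (2 * n)) (c (2 * n + 1)) *
            ∑ u, G (c 0) (c 1) u u) := by
        simp only [← Finset.mul_sum, sum_delta_mul]
      rw [← e1, ← e2, ← Finset.sum_add_distrib, Finset.mul_sum]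
      refine Finset.sum_congr rfl fun u _ => ?_
      rw [← Finset.sum_add_distrib, Finset.mul_sum]
      refine Finset.sum_congr rfl fun v _ => ?_
      simp only [weight, List.map_nil, List.prod_nil]
      ring
    rw [hr, sumOver_insert (by simp), sumOver_insert (by simp)]
    simp only [hstep]
    rw [ih fun x y x' y' => α * G x y x' y' + β * (delta x' y' * ∑ u, G x y u u)]
    have s1 : ∑ x, ∑ y, (α * G x y x y + β * (delta x y * ∑ u, G x y u u)) =
        α * ∑ x, ∑ y, G x y x y + β * ∑ x, ∑ y, G x x y y := by
      simp only [Finset.sum_add_distrib, ← Finset.mul_sum, sum_delta_mul]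
    have s2 : ∑ x, ∑ y, (α * G x x y y + β * (delta y y * ∑ u, G x x u u)) =
        (α + 3 * β) * ∑ x, ∑ y, G x x y y := by
      simp only [Finset.sum_add_distrib, ← Finset.mul_sum, delta_self, one_mul, Finset.sum_const,
        Finset.card_univ, Fintype.card_fin, nsmul_eq_mul]
      push_cast
      ring
    rw [s1, s2]
    ring

/-- The closure takes the trace of the `n`-th power of the transfer matrix on the nine pairs of
colours. Its eigenvalues are `α` with multiplicity eight and `α + 3 * β` once, and the latter is `p
^ 3` or `q ^ 3`. -/
theorem partition_foil_replicate {p q : ℝ} (hpq : p * q = -1) (hs : p ^ 2 + q ^ 2 = 3) (n : ℕ)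
    (b : Bool) : partition p q (foil (List.replicate n b)) =
      if b then 8 * q ^ n + (p ^ 3) ^ n else 8 * p ^ n + (q ^ 3) ^ n := by
  have hE : edgeNames (foil (List.replicate n b)).darts = Finset.range (2 * n + 2) := by
    ext e
    simp only [mem_edgeNames, mem_darts_foil, List.length_replicate, Finset.mem_range]
    exact ⟨fun ⟨x, hx, h⟩ => h ▸ hx, fun h => ⟨(e, true), h, rfl⟩⟩
  have h := sumOver_twist_replicate (p := p) (q := q) (b := b) rfl rfl n
    fun x y x' y' => delta x x' * delta y y'
  have hW : weight p q (foil (List.replicate n b)) = fun c =>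
      weight p q (twist 0 (List.replicate n b)) c *
        (delta (c 0) (c (2 * n)) * delta (c 1) (c (2 * n + 1))) := by
    funext c
    rw [foil, weight_append]
    simp [closingArcs, weight, Piece.weight]
  rw [partition, hE, hW, h]
  simp only [delta_self, sum_delta_mul, Finset.sum_const, Finset.card_univ, Fintype.card_fin,
    nsmul_eq_mul]
  cases b
  · simp only [Bool.false_eq_true, if_false, cube_snd hpq hs]
    push_cast
    ring
  · simp only [if_true, cube_fst hpq hs, add_comm (3 * p)]
    push_cast
    ring

namespace Diagram

/-- Without first Reidemeister moves no power of `p` is lost; this sharper invariance separates the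
two 1-foils. -/
theorem abs_partition_of_cancelsTo {p q : ℝ} (hpq : p * q = -1) (hs : p ^ 2 + q ^ 2 = 3)
    {D D' : Diagram} (h : CancelsTo D D') : |D.partition p q| = |D'.partition p q| := by
  induction h with
  | refl => rfl
  | tail _ h ih =>
    rw [ih]
    obtain ⟨h1, h2, h | h | h⟩ := h
    · rw [partition_planarIsotopy h1.closed h]
    · rw [partition_planarIsotopy h2.closed h]
    · rw [partition_reidemeisterII hpq hs h1.closed h, abs_neg]

/-- Since `|q| = p⁻¹`, both kink factors are integer powers of `p` up to sign. -/
theorem abs_partition_of_sameKnot {p q : ℝ} (hp : 0 < p) (hpq : p * q = -1)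
    (hs : p ^ 2 + q ^ 2 = 3) {D D' : Diagram} (h : SameKnot D D') :
    ∃ m : ℤ, |D.partition p q| = p ^ m * |D'.partition p q| := by
  have hq : |q| = p⁻¹ := by
    refine eq_inv_of_mul_eq_one_left ?_
    conv_lhs => rw [← abs_of_pos hp]
    rw [← abs_mul, mul_comm, hpq, abs_neg, abs_one]
  induction h with
  | rel D D' h =>
    obtain ⟨h1, h2, h | h | h | h⟩ := h
    · exact ⟨0, by rw [partition_planarIsotopy h1.closed h]; simp⟩
    · rcases partition_reidemeisterI hpq hs h1.closed h with h | h
      · exact ⟨3, by rw [h, abs_mul, abs_pow, abs_of_pos hp]; norm_cast⟩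
      · exact ⟨-3, by rw [h, abs_mul, abs_pow, hq, inv_pow, zpow_neg]; norm_cast⟩
    · exact ⟨0, by rw [partition_reidemeisterII hpq hs h1.closed h]; simp⟩
    · exact ⟨0, by rw [partition_reidemeisterIII hpq hs h1.closed h]; simp⟩
  | refl D => exact ⟨0, by simp⟩
  | symm D D' _ ih =>
    obtain ⟨m, hm⟩ := ih
    refine ⟨-m, ?_⟩
    rw [hm, ← mul_assoc, ← zpow_add₀ hp.ne']
    simp
  | trans D D' D'' _ _ ih₁ ih₂ =>
    obtain ⟨m, hm⟩ := ih₁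
    obtain ⟨m', hm'⟩ := ih₂
    exact ⟨m + m', by rw [hm, hm', zpow_add₀ hp.ne', mul_assoc]⟩

theorem CancelsTo.sameKnot {D D' : Diagram} (h : CancelsTo D D') : SameKnot D D' := by
  induction h with
  | refl => exact .refl _
  | tail _ h ih =>
    refine ih.trans _ _ _ ?_
    obtain ⟨h1, h2, h | h | h⟩ := h
    · exact .rel _ _ ⟨h1, h2, .inl h⟩
    · exact .symm _ _ (.rel _ _ ⟨h2, h1, .inl h⟩)
    · exact .rel _ _ ⟨h1, h2, .inr (.inr (.inl h))⟩

end Diagram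

/-! Values of the invariant -/

/-- The part of the invariant of the left (`true`) or right (`false`) `k`-foil that is not a power
of `g`. -/
noncomputable def foilValue (g : ℝ) (k : ℕ) (b : Bool) : ℝ :=
  if k = 1 then 3 else if b then 1 - 8 * (g ^ (4 * k))⁻¹ else 8 - (g ^ (4 * k))⁻¹

section Golden

variable {g : ℝ} (hg : g ^ 2 = g + 1) (h1 : 1.618 < g) (h2 : g < 1.6181)

include hg in
theorem golden_pow_four : g ^ 4 = 3 * g + 2 := by linear_combination (g ^ 2 + g + 2) * hg

include hg in
theorem golden_pow_five : g ^ 5 = 5 * g + 3 := by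
  linear_combination g * golden_pow_four hg + 3 * hg

include hg in
theorem golden_pow_twelve : g ^ 12 = 144 * g + 89 := by
  have h8 : g ^ 8 = 21 * g + 13 := by
    linear_combination (g ^ 4 + 3 * g + 2) * golden_pow_four hg + 9 * hg
  linear_combination g ^ 4 * h8 + (21 * g + 13) * golden_pow_four hg + 63 * hg

include hg h1 h2 in
theorem inv_golden_pow_lt {k : ℕ} (hk : 3 ≤ k) :
    0 < (g ^ (4 * k))⁻¹ ∧ (g ^ (4 * k))⁻¹ < 1 / 300 := by
  have h0 : 0 < g := by linarith
  have h : 300 < g ^ (4 * k) := by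
    calc (300 : ℝ) < g ^ 12 := by rw [golden_pow_twelve hg]; linarith
      _ ≤ g ^ (4 * k) := pow_le_pow_right₀ (by linarith) (by omega)
  refine ⟨by positivity, ?_⟩
  rw [one_div]
  exact inv_strictAnti₀ (by norm_num) h

include hg h1 h2 in
/-- An integer power of the golden ratio is not in certain intervals. -/
theorem golden_zpow_gap (m : ℤ) :
    (0.7 < g ^ m → g ^ m < 1.5 → g ^ m = 1) ∧ ¬ (2.62 < g ^ m ∧ g ^ m < 4) ∧
      ¬ (7 < g ^ m ∧ g ^ m < 11) := by
  have h0 : 1 < g := by linarith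
  have hpos : 0 < g := by linarith
  have up : ∀ k : ℤ, k ≤ m → g ^ k ≤ g ^ m := fun k hk => zpow_le_zpow_right₀ h0.le hk
  have dn : ∀ k : ℤ, m ≤ k → g ^ m ≤ g ^ k := fun k hk => zpow_le_zpow_right₀ h0.le hk
  have e1 : g ^ (1 : ℤ) = g := zpow_one g
  have e2 : g ^ (2 : ℤ) = g + 1 := by rw [← hg]; norm_cast
  have e3 : g ^ (3 : ℤ) = 2 * g + 1 := by
    have : g ^ 3 = 2 * g + 1 := by linear_combination (g + 1) * hg
    rw [← this]; norm_cast
  have e4 : g ^ (4 : ℤ) = 3 * g + 2 := by rw [← golden_pow_four hg]; norm_cast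
  have e5 : g ^ (5 : ℤ) = 5 * g + 3 := by rw [← golden_pow_five hg]; norm_cast
  have en : g ^ (-1 : ℤ) = g - 1 := by
    rw [zpow_neg_one]
    refine inv_eq_of_mul_eq_one_right ?_
    linear_combination hg
  -- The neighbours of `1` are `g⁻¹ ≈ 0.618` and `g ≈ 1.618`; the other intervals fit between `g ^ 2
  -- ≈ 2.618` and `g ^ 3 ≈ 4.236`, and between `g ^ 4 ≈ 6.854` and `g ^ 5 ≈ 11.09`.
  refine ⟨fun ha hb => ?_, fun ⟨ha, hb⟩ => ?_, fun ⟨ha, hb⟩ => ?_⟩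
  · rcases eq_or_ne m 0 with rfl | hm
    · exact zpow_zero g
    exfalso
    rcases lt_or_gt_of_ne hm with h | h
    · have := dn (-1) (by omega)
      rw [en] at this
      linarith
    · have := up 1 (by omega)
      rw [e1] at this
      linarith
  · rcases le_or_gt m 2 with h | h
    · have := dn 2 h
      rw [e2] at this
      linarith
    · have := up 3 (by omega)
      rw [e3] at this
      linarith
  · rcases le_or_gt m 4 with h | h
    · have := dn 4 h
      rw [e4] at this
      linarith
    · have := up 5 (by omega)
      rw [e5] at this
      linarith

include hg h1 h2 in
-- The values are `3`, or just below `1`, or just below `8`. Different kinds have a ratio near `3`,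
-- `8 / 3` or `8`, up to inversion, and these lie in the gaps between the powers of `g`. For equal
-- kinds the ratio is near `1`, so the power is `1` and the correction terms agree.
theorem foilValue_eq_zpow_mul {j k : ℕ} (hj : Odd j) (hk : Odd k) {b c : Bool} {m : ℤ}
    (h : foilValue g j b = g ^ m * foilValue g k c) : (j = 1 ∧ k = 1) ∨ (j = k ∧ b = c) := by
  have hpos : 0 < g := by linarith
  have hm := golden_zpow_gap hg h1 h2 m
  have hm' := golden_zpow_gap hg h1 h2 (-m)
  have hmm : g ^ m * g ^ (-m) = 1 := by rw [← zpow_add₀ hpos.ne']; simp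
  have hz := zpow_pos hpos m
  have hz' := zpow_pos hpos (-m)
  have h' : g ^ (-m) * foilValue g j b = foilValue g k c := by
    rw [h, ← mul_assoc, mul_comm (g ^ (-m)), hmm, one_mul]
  have inj : (g ^ (4 * j))⁻¹ = (g ^ (4 * k))⁻¹ → j = k := fun h => by
    have := pow_right_injective₀ hpos (by linarith) (inv_injective h)
    omega
  have odd3 : ∀ {i : ℕ}, Odd i → i ≠ 1 → 3 ≤ i := fun ⟨r, hr⟩ h => by omega
  -- With the power and its inverse as plain variables, each case is arithmetic; the one of the two
  -- that exceeds `1` is compared with the gaps.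
  generalize g ^ m = x at *
  generalize g ^ (-m) = y at *
  by_cases hj1 : j = 1 <;> by_cases hk1 : k = 1
  · exact .inl ⟨hj1, hk1⟩
  · exfalso
    have hb := inv_golden_pow_lt hg h1 h2 (odd3 hk hk1)
    simp only [foilValue, hj1, hk1, if_true, if_false] at h h'
    cases c <;> simp only [Bool.false_eq_true, if_true, if_false] at h h'
    · exact hm'.2.1 ⟨by linarith, by linarith⟩
    · exact hm.2.1 ⟨by nlinarith, by nlinarith⟩
  · exfalso
    have hb := inv_golden_pow_lt hg h1 h2 (odd3 hj hj1)
    simp only [foilValue, hj1, hk1, if_true, if_false] at h h'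
    cases b <;> simp only [Bool.false_eq_true, if_true, if_false] at h h'
    · exact hm.2.1 ⟨by linarith, by linarith⟩
    · exact hm'.2.1 ⟨by nlinarith, by nlinarith⟩
  · have hb := inv_golden_pow_lt hg h1 h2 (odd3 hj hj1)
    have hb' := inv_golden_pow_lt hg h1 h2 (odd3 hk hk1)
    simp only [foilValue, hj1, hk1, if_false] at h h'
    cases b <;> cases c <;> simp only [Bool.false_eq_true, if_true, if_false] at h h'
    · obtain rfl := hm.1 (by nlinarith) (by nlinarith)
      exact .inr ⟨inj (by linarith), rfl⟩
    · exact absurd ⟨by nlinarith, by nlinarith⟩ hm.2.2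
    · exact absurd ⟨by nlinarith, by nlinarith⟩ hm'.2.2
    · obtain rfl := hm.1 (by nlinarith) (by nlinarith)
      exact .inr ⟨inj (by linarith), rfl⟩

end Golden

end FreeKnot

/-! ### Distinguishing the foils and counting assignments -/

namespace FreeKnot
open Diagram

/-- The case `k = 1` stands apart: `8 * q + p ^ 3` is negative here, unlike for larger odd `k`, and
both values are exactly `3` times a power of `g`. -/
theorem abs_partition_foil_one {g : ℝ} (hg : g ^ 2 = g + 1) (h1 : 1.618 < g) :
    |partition g (-g⁻¹) (foil [true])| = g ^ (-3 : ℤ) * 3 ∧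
    |partition g (-g⁻¹) (foil [false])| = g ^ (3 : ℤ) * 3 := by
  have h0 : g ≠ 0 := by linarith
  have hi : g⁻¹ = g - 1 := inv_eq_of_mul_eq_one_right (by linear_combination hg)
  have hpq : g * -g⁻¹ = -1 := by rw [mul_neg, mul_inv_cancel₀ h0]
  have hs : g ^ 2 + (-g⁻¹) ^ 2 = 3 := by rw [hi]; linear_combination 2 * hg
  have ht := partition_foil_replicate hpq hs 1 true
  have hf := partition_foil_replicate hpq hs 1 false
  have h3 : g ^ 3 = 2 * g + 1 := by linear_combination (g + 1) * hg
  have h3' : (g - 1) ^ 3 = 2 * g - 3 := by linear_combination (g - 2) * hg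
  simp only [List.replicate_one, pow_one, if_true, if_false, Bool.false_eq_true] at ht hf
  constructor
  · rw [ht, zpow_neg, ← inv_zpow, hi, abs_of_neg]
    · norm_cast
      rw [h3', h3]
      ring
    · rw [h3]; linarith
  · rw [hf, hi, abs_of_pos]
    · norm_cast
      rw [Odd.neg_pow (by decide), h3', h3]
      ring
    · rw [Odd.neg_pow (by decide), h3']; linarith

theorem abs_partition_foil {g : ℝ} (hg : g ^ 2 = g + 1) (h1 : 1.618 < g) (h2 : g < 1.6181)
    {k : ℕ} (hk : Odd k) (b : Bool) :
    ∃ n : ℤ, |partition g (-g⁻¹) (foil (List.replicate k b))| = g ^ n * foilValue g k b := by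
  have hpos : 0 < g := by linarith
  have h0 : g ≠ 0 := hpos.ne'
  by_cases hk1 : k = 1
  · subst hk1
    obtain ⟨ht, hf⟩ := abs_partition_foil_one hg h1
    cases b
    · exact ⟨3, by rw [List.replicate_one, hf, foilValue, if_pos rfl]⟩
    · exact ⟨-3, by rw [List.replicate_one, ht, foilValue, if_pos rfl]⟩
  have hi : g⁻¹ = g - 1 := inv_eq_of_mul_eq_one_right (by linear_combination hg)
  have hpq : g * -g⁻¹ = -1 := by rw [mul_neg, mul_inv_cancel₀ h0]
  have hs : g ^ 2 + (-g⁻¹) ^ 2 = 3 := by rw [hi]; linear_combination 2 * hg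
  have hk3 : 3 ≤ k := by obtain ⟨r, hr⟩ := hk; omega
  have hb := inv_golden_pow_lt hg h1 h2 hk3
  have hgk : g ^ k ≠ 0 := pow_ne_zero k h0
  rw [partition_foil_replicate hpq hs, foilValue, if_neg hk1]
  cases b
  · refine ⟨k, ?_⟩
    have : 8 * g ^ k + ((-g⁻¹) ^ 3) ^ k = g ^ (k : ℤ) * (8 - (g ^ (4 * k))⁻¹) := by
      rw [Odd.neg_pow (by decide), hk.neg_pow, zpow_natCast, mul_comm 4 k, pow_mul g k 4,
        ← pow_mul, mul_comm 3 k, pow_mul, inv_pow]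
      field_simp
      ring
    simp only [Bool.false_eq_true, if_false]
    rw [this, abs_of_nonneg]
    have := zpow_pos hpos k
    exact mul_nonneg this.le (by linarith)
  · refine ⟨(3 * k : ℕ), ?_⟩
    have : 8 * (-g⁻¹) ^ k + (g ^ 3) ^ k = g ^ ((3 * k : ℕ) : ℤ) * (1 - 8 * (g ^ (4 * k))⁻¹) := by
      rw [hk.neg_pow, zpow_natCast, mul_comm 4 k, pow_mul g k 4,
        ← pow_mul, mul_comm 3 k, pow_mul, inv_pow]
      field_simp
      ring
    simp only [if_true]
    rw [this, abs_of_nonneg]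
    have := zpow_pos hpos (3 * k : ℕ)
    exact mul_nonneg this.le (by linarith)

theorem exists_golden : ∃ g : ℝ, g ^ 2 = g + 1 ∧ 1.618 < g ∧ g < 1.6181 := by
  refine ⟨Real.goldenRatio, Real.goldenRatio_sq, ?_, ?_⟩
  · have : (2.236 : ℝ) < √5 := Real.lt_sqrt_of_sq_lt (by norm_num)
    rw [Real.goldenRatio]
    linarith
  · have : √5 < (2.2362 : ℝ) := (Real.sqrt_lt' (by norm_num)).2 (by norm_num)
    rw [Real.goldenRatio]
    linarith

theorem golden_relations {g : ℝ} (hg : g ^ 2 = g + 1) (h1 : 1.618 < g) :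
    0 < g ∧ g * -g⁻¹ = -1 ∧ g ^ 2 + (-g⁻¹) ^ 2 = 3 := by
  have hpos : 0 < g := by linarith
  have hi : g⁻¹ = g - 1 := inv_eq_of_mul_eq_one_right (by linear_combination hg)
  exact ⟨hpos, by rw [mul_neg, mul_inv_cancel₀ hpos.ne'], by rw [hi]; linear_combination 2 * hg⟩

theorem sameKnot_foil_replicate {j k : ℕ} (hj : Odd j) (hk : Odd k) {b c : Bool}
    (h : SameKnot (foil (List.replicate j b)) (foil (List.replicate k c))) :
    (j = 1 ∧ k = 1) ∨ (j = k ∧ b = c) := by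
  obtain ⟨g, hg, h1, h2⟩ := exists_golden
  obtain ⟨hpos, hpq, hs⟩ := golden_relations hg h1
  obtain ⟨m, hm⟩ := abs_partition_of_sameKnot hpos hpq hs h
  obtain ⟨n, hn⟩ := abs_partition_foil hg h1 h2 hj b
  obtain ⟨n', hn'⟩ := abs_partition_foil hg h1 h2 hk c
  rw [hn, hn'] at hm
  refine foilValue_eq_zpow_mul hg h1 h2 hj hk (m := -n + (m + n')) ?_
  rw [zpow_add₀ hpos.ne', zpow_add₀ hpos.ne', mul_assoc, mul_assoc, ← hm, ← mul_assoc,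
    ← zpow_add₀ hpos.ne']
  simp

/-- Knot type decides everything except the letter for `j = k = 1`; there the exact absolute values
`3 * g ^ (-3)` and `3 * g ^ 3` differ. -/
theorem cancelsTo_foil_replicate {j k : ℕ} (hj : Odd j) (hk : Odd k) {b c : Bool}
    {D : Diagram} (hD : CancelsTo D (foil (List.replicate j b)))
    (hD' : CancelsTo D (foil (List.replicate k c))) : j = k ∧ b = c := by
  rcases sameKnot_foil_replicate hj hk (hD.sameKnot.symm.trans _ _ _ hD'.sameKnot) with
    ⟨rfl, rfl⟩ | h
  · refine ⟨rfl, ?_⟩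
    obtain ⟨g, hg, h1, h2⟩ := exists_golden
    obtain ⟨hpos, hpq, hs⟩ := golden_relations hg h1
    have e := (abs_partition_of_cancelsTo hpq hs hD).symm.trans
      (abs_partition_of_cancelsTo hpq hs hD')
    obtain ⟨ht, hf⟩ := abs_partition_foil_one hg h1
    have hlt : g ^ (-3 : ℤ) < g ^ (3 : ℤ) := zpow_lt_zpow_right₀ (by linarith) (by norm_num)
    simp only [List.replicate_one] at e
    cases b <;> cases c <;> first | rfl | (rw [ht, hf] at e; linarith)
  · exact h

theorem isKnotDiagram_unknot : unknot.IsKnotDiagram := by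
  have hd : unknot.darts = [(0, false), (0, true)] := rfl
  have hm : ∀ x : Dart, x ∈ unknot.darts ↔ x.1 = 0 := by
    rintro ⟨e, _ | _⟩ <;> simp [hd]
  refine ⟨⟨by rw [hd]; decide, fun x hx => (hm _).2 ((hm x).1 hx)⟩, ?_, ?_⟩
  · rw [componentCount, Nat.card_eq_one_iff_exists]
    refine ⟨Quot.mk _ ⟨(0, false), by simp [hm]⟩, ?_⟩
    rintro ⟨⟨⟨e, _ | _⟩, hx⟩⟩
    · obtain rfl : e = 0 := (hm _).1 hx
      rfl
    · obtain rfl : e = 0 := (hm _).1 hx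
      exact Quot.sound (.inl rfl)
  · have hstep : ∀ x y, unknot.FaceStep x y → x = y := by
      rintro ⟨x, hx⟩ ⟨y, hy⟩ ⟨p, hp, h, hxh, hyh⟩
      obtain rfl : p = _ := List.mem_singleton.1 hp
      simp only [Piece.corners, List.mem_cons, Prod.mk.injEq, List.not_mem_nil, or_false] at hxh
      simp only at hyh
      subst hyh
      rcases hxh with ⟨rfl, rfl⟩ | ⟨rfl, rfl⟩ <;> rfl
    have hcard : unknot.faceCount = 2 := by
      have e : Quot unknot.FaceStep ≃ {h // h ∈ unknot.darts} :=
        ⟨Quot.lift id hstep, Quot.mk _, by rintro ⟨x⟩; rfl, fun _ => rfl⟩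
      rw [faceCount, Nat.card_congr e, Nat.subtype_card unknot.darts.toFinset (by simp)]
      rfl
    rw [hcard]
    rfl

theorem sameKnot_foil_one_unknot (b : Bool) : SameKnot (foil [b]) unknot := by
  have k0 : (foil [b]).IsKnotDiagram := isKnotDiagram_foil (by simp)
  have hp : (foil [b]).Perm [.arc (0, false) (2, true), .arc (1, false) (3, true), column 0 b] :=
    (List.perm_append_comm (l₁ := [column 0 b]) (l₂ := closingArcs 1))
  have k1 := k0.perm hp
  have n1 : ((2, true) : Dart) ≠ Dart.flip (0, false) := by decide
  have n2 : ((3, true) : Dart) ≠ Dart.flip (1, false) := by decide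
  obtain ⟨c2, i2⟩ := isClosed_smooth_and_isKnotDiagram_smooth_iff n1 k1.closed
  have k2 := i2.1 k1
  have s1 := PlanarIsotopy.smooth _ _ n1 [.arc (1, false) (3, true), column 0 b]
  obtain ⟨c3, i3⟩ := isClosed_smooth_and_isKnotDiagram_smooth_iff n2 c2
  have k3 := i3.1 k2
  have s2 := PlanarIsotopy.smooth _ _ n2 [(column 0 b).map fun x =>
    if x = Dart.flip (2, true) then (0, false) else x]
  have t1 : SameKnot (foil [b]) _ := .rel _ _ ⟨k0, k1, .inl (.perm _ _ hp)⟩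
  have t2 := t1.trans _ _ _ (.rel _ _ ⟨k1, k2, .inl s1⟩)
  have t3 := t2.trans _ _ _ (.rel _ _ ⟨k2, k3, .inl s2⟩)
  refine t3.trans _ _ _ ?_
  -- After the two smoothings a single kink remains, and the assignment decides which form of the
  -- first move removes it.
  cases b
  · exact .rel _ _ ⟨k3, isKnotDiagram_unknot, .inr (.inl
      (.under_first (1, true) (0, false) (0, true) []))⟩
  · have r : SameKnot [.arc (0, true) (0, false)] unknot :=
      .rel _ _ ⟨isKnotDiagram_unknot.reverse, isKnotDiagram_unknot, .inl (.reverse _ _ [])⟩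
    exact .trans _ _ _ (.rel _ _ ⟨k3, isKnotDiagram_unknot.reverse, .inr (.inl
      (.over_first (1, true) (0, true) (0, false) []))⟩) r

theorem eq_one_of_sameKnot_unknot {j : ℕ} (hj : Odd j) {b : Bool}
    (h : SameKnot (foil (List.replicate j b)) unknot) : j = 1 := by
  have := (sameKnot_foil_one_unknot true).symm
  rcases sameKnot_foil_replicate hj odd_one (c := true) (h.trans _ _ _ this) with h | h
  · exact h.1
  · exact h.1

theorem cancelsTo_foil_iff {w : List Bool} (hw : Odd w.length) {k : ℕ} (hk : Odd k) (c : Bool) :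
    CancelsTo (foil w) (foil (List.replicate k c)) ↔ w.count c = w.count (!c) + k := by
  obtain ⟨j, b, hj, hc, h⟩ := exists_cancelsTo_replicate w hw
  constructor
  · intro h'
    obtain ⟨rfl, rfl⟩ := cancelsTo_foil_replicate hj hk h h'
    exact hc
  · intro h'
    have hk0 := hk.pos
    have hj0 := hj.pos
    -- As `j` and `k` are positive, the sign of the difference of the counts determines the letter
    -- and its size the length.
    have : b = c ∧ j = k := by
      cases b <;> cases c <;> simp only [Bool.not_true, Bool.not_false] at hc h' <;>
        refine ⟨?_, ?_⟩ <;> first | rfl | omega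
    rwa [← this.1, ← this.2]

theorem sameKnot_foil_iff {w : List Bool} (hw : Odd w.length) {k : ℕ} (hk : Odd k) (hk3 : 3 ≤ k)
    (c : Bool) :
    SameKnot (foil w) (foil (List.replicate k c)) ↔ w.count c = w.count (!c) + k := by
  refine ⟨fun h' => ?_, fun h => ((cancelsTo_foil_iff hw hk c).2 h).sameKnot⟩
  obtain ⟨j, b, hj, hc, h⟩ := exists_cancelsTo_replicate w hw
  rcases sameKnot_foil_replicate hj hk (h.sameKnot.symm.trans _ _ _ h') with h | ⟨rfl, rfl⟩
  · omega
  · exact hc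

theorem sameKnot_foil_unknot_iff {w : List Bool} (hw : Odd w.length) :
    SameKnot (foil w) unknot ↔
      w.count true = w.count false + 1 ∨ w.count false = w.count true + 1 := by
  obtain ⟨j, b, hj, hc, h⟩ := exists_cancelsTo_replicate w hw
  constructor
  · intro h'
    obtain rfl := eq_one_of_sameKnot_unknot hj (h.sameKnot.symm.trans _ _ _ h')
    cases b
    · exact .inr hc
    · exact .inl hc
  · rintro (h | h)
    · exact ((cancelsTo_foil_iff hw odd_one true).2 h).sameKnot.trans _ _ _
        (sameKnot_foil_one_unknot true)
    · exact ((cancelsTo_foil_iff hw odd_one false).2 h).sameKnot.trans _ _ _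
        (sameKnot_foil_one_unknot false)

open Finset in
theorem card_filter_count_ofFn (n m : ℕ) (b : Bool) :
    #{s : Fin n → Bool | (List.ofFn s).count b = m} = n.choose m := by
  have hcount : ∀ s : Fin n → Bool, (List.ofFn s).count b = #{i | s i = b} := fun s => by
    have := Fin.card_filter_univ_eq_vector_get_eq_count b (List.Vector.ofFn s)
    simpa using this.symm
  conv_rhs => rw [← Fintype.card_fin n, ← Finset.card_univ, ← Finset.card_powersetCard]
  refine Finset.card_bij' (fun s _ => ({i | s i = b} : Finset (Fin n)))
    (fun S _ i => if i ∈ S then b else !b) ?_ ?_ ?_ ?_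
  · intro s hs
    simp only [mem_filter, mem_univ, true_and, hcount] at hs
    simpa [mem_powersetCard] using hs
  · intro S hS
    rw [mem_powersetCard] at hS
    simp only [mem_filter, mem_univ, true_and, hcount]
    rw [← hS.2]
    congr 1
    ext i
    by_cases h : i ∈ S <;> simp [h]
  · intro s _
    funext i
    by_cases h : s i = b
    · simp [h]
    · cases b <;> simp_all
  · intro S _
    ext i
    by_cases h : i ∈ S <;> simp [h]

/-- The two counts add up to `n` and differ by `k`, so the condition says that the letter `!c`
occurs `(n - k) / 2` times; the division is exact because both numbers are odd. -/
theorem natCard_assignment {n k : ℕ} (hn : Odd n) (hk : Odd k) (hkn : k ≤ n) (c : Bool)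
    {P : Assignment n → Prop}
    (hP : ∀ s, P s ↔ (List.ofFn s).count c = (List.ofFn s).count (!c) + k) :
    Nat.card {s // P s} = n.choose ((n - k) / 2) := by
  rw [← card_filter_count_ofFn n ((n - k) / 2) (!c)]
  refine Nat.subtype_card _ fun s => ?_
  have h := List.count_add_count_not (List.ofFn s) c
  rw [List.length_ofFn] at h
  obtain ⟨r, hr⟩ := hn
  obtain ⟨t, ht⟩ := hk
  simp only [Finset.mem_filter, Finset.mem_univ, true_and, hP]
  omega

end FreeKnot

open FreeKnot FreeKnot.Diagram in
theorem mainTheorem3 (n : ℕ) (hn : Odd n) :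
    (∀ s : Assignment n, IsKnotDiagram ((freeFoil n).resultant s)) ∧
    (∀ k : ℕ, Odd k → k ≤ n →
      Nat.card {s : Assignment n // CancelsTo ((freeFoil n).resultant s) (leftFoil k)}
        = n.choose ((n - k) / 2) ∧
      Nat.card {s : Assignment n // CancelsTo ((freeFoil n).resultant s) (rightFoil k)}
        = n.choose ((n - k) / 2)) ∧
    (∀ k : ℕ, Odd k → 3 ≤ k → k ≤ n →
      Nat.card {s : Assignment n // SameKnot ((freeFoil n).resultant s) (leftFoil k)}
        = n.choose ((n - k) / 2) ∧
      Nat.card {s : Assignment n // SameKnot ((freeFoil n).resultant s) (rightFoil k)}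
        = n.choose ((n - k) / 2)) ∧
    Nat.card {s : Assignment n // SameKnot ((freeFoil n).resultant s) unknot}
      = 2 * n.choose ((n - 1) / 2) := by
  have hw : ∀ s : Assignment n, Odd (List.ofFn s).length := fun s => by rwa [List.length_ofFn]
  refine ⟨fun s => ?_, fun k hk hkn => ⟨?_, ?_⟩, fun k hk hk3 hkn => ⟨?_, ?_⟩, ?_⟩
  · rw [resultant_freeFoil]
    exact isKnotDiagram_foil (hw s)
  · refine natCard_assignment hn hk hkn true fun s => ?_
    rw [resultant_freeFoil, leftFoil_eq, cancelsTo_foil_iff (hw s) hk]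
  · refine natCard_assignment hn hk hkn false fun s => ?_
    rw [resultant_freeFoil, rightFoil_eq, cancelsTo_foil_iff (hw s) hk]
  · refine natCard_assignment hn hk hkn true fun s => ?_
    rw [resultant_freeFoil, leftFoil_eq, sameKnot_foil_iff (hw s) hk hk3]
  · refine natCard_assignment hn hk hkn false fun s => ?_
    rw [resultant_freeFoil, rightFoil_eq, sameKnot_foil_iff (hw s) hk hk3]
  · have h : ∀ c, Nat.card {s : Assignment n //
        (List.ofFn s).count c = (List.ofFn s).count (!c) + 1} = n.choose ((n - 1) / 2) :=
      fun c => natCard_assignment hn odd_one hn.pos c fun _ => Iff.rfl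
    -- The unknot arises from an excess of one in either letter, and the two cases exclude each
    -- other.
    rw [two_mul]
    nth_rewrite 1 [← h true]
    rw [← h false, ← Nat.card_sum]
    refine Nat.card_congr ((Equiv.subtypeEquivRight fun s => ?_).trans
      (subtypeOrEquiv _ _ ?_))
    · rw [resultant_freeFoil, sameKnot_foil_unknot_iff (hw s)]
      rfl
    · rw [Pi.disjoint_iff]
      intro s
      rw [Prop.disjoint_iff]
      simp only [Bool.not_true, Bool.not_false]
      omega
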